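/- Let $M\subset\mathbb{R}^{n+k}$ be an $n$-dimensional embedded $C^2$-submanifold and let $\phi\colon TM\to M$ be any function (a parametrisation; no continuity is assumed); $\phi_p$ denotes its restriction to $T_pM$. All norms are Euclidean, $B(0;r)$ is the open ball of radius $r$, and $\|D^2f(x)\|=\sup_{\|\eta\|=1}\|D^2f(x)\cdot(\eta,\eta)\|$; a bound on $\|D^2f(x)\|$ includes the existence of $D^2f(x)$. **Conditions C1, C2.** For a $C^2$-chart $(U,\varphi)$ of $M$ put $\widehat\phi_x(y)=\varphi\big(\phi_p(D\varphi(p)^{-1}y)\big)$ with $p=\varphi^{-1}(x)$, defined for those $(x,y)\in\mathbb{R}^n\times\mathbb{R}^n$ for which $x\in\varphi(U)$ and $\phi_p(D\varphi(p)^{-1}y)\in U$. The map $\phi$ satisfies C1 (respectively C2) if for every $p\in M$ there are a $C^2$-chart $(U,\varphi)$ with $\varphi(p)=0$ and a $\rho>0$ such that - (C1) for every $x\in B(0;\rho)$, $\widehat\phi_x$ is defined on some ball about $0$, $\widehat\phi_x(0)=x$, $D\widehat\phi_x(0)=I$, and there is a constant $\alpha$ with $\|D^2\widehat\phi_x(0)\|\le\alpha$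 for all $x\in B(0;\rho)$; - (C2) $\widehat\phi_x(y)$ is defined for all $x,y\in B(0;\rho)$ and there is a constant $\beta$ with $\|\widehat\phi_x(y)-x-y\|\le\beta\|y\|^2$ for all $x,y\in B(0;\rho)$. A pair $(\phi,\psi)$ satisfies C1--C2 if for every $p$ one can choose a common chart and a common $\rho$ such that $\phi$ satisfies (C1) and $\psi$ satisfies (C2). **Condition D.** For $\delta>0$ let $\mathfrak{H}_\delta$ be the set of $C^2$ maps $h\colon B(0;\delta)\subset\mathbb{R}^n\to\mathbb{R}^k$ with $h(0)=0$, $Dh(0)=0$ and $\sup_{t\in B(0;\delta)}\|D^2h(t)\|<\infty$. For each $x\in M$ fix a rotation $R_x$ of $\mathbb{R}^{n+k}$ sending $T_xM$ (as a linear subspace of $\mathbb{R}^{n+k}$) onto $\mathbb{R}^n\times\{0\}$. Call $(x,\delta,h)$, with $x\in M$, $\delta>0$, $h\in\mathfrak{H}_\delta$, admissible if there is an open $U\subset\mathbb{R}^{n+k}$ with $R_x(M-x)\cap U=\{(t,h(t)) : t\in B(0;\delta)\}$. For an admissible triple let $\pi$ be the partial map from $\mathbb{R}^n$ to $B(0;\delta)\subset\mathbb{R}^n$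 determined by $$(\pi(y),h(\pi(y)))=R_x\big(\phi_x(R_x^{-1}(y,0))-x\big),$$ defined at those $y$ for which the right-hand side lies in the graph $\{(t,h(t)) : t\in B(0;\delta)\}$, and put $K=\sup_{t\in B(0;\delta)}\|D^2h(t)\|$. For functions $\alpha,\beta,\rho\colon(0,\infty)\times[0,\infty)\to\mathbb{R}$ consider the conditions that, for all admissible $(x,\delta,h)$, - (D1) $\pi$ is defined on $B(0;\rho(\delta,K))$; - (D2) $\|D^2\pi(0)\|\le\alpha(\delta,K)$; - (D3) $\|\pi(y)-y\|\le\beta(\delta,K)\|y\|^2$ for $y\in B(0;\rho(\delta,K))$; and, for all $\delta>0$ and $\bar K\ge0$, - (D4) $\sup_{K\in[0,\bar K]}\alpha(\delta,K)<\infty$; - (D5) $\sup_{K\in[0,\bar K]}\beta(\delta,K)<\infty$; - (D6) $\inf_{K\in[0,\bar K]}\rho(\delta,K)>0$. **Proposition.** 1. If there are $\alpha,\beta,\rho$ for which D1--D6 hold, then the pair $(\phi,\phi)$ satisfies C1--C2. 2. If there are $\alpha,\rho$ for which D1, D2, D4 hold, $\rho(\delta,K)>0$ for all $\delta>0$ and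 $K\ge0$, and $\pi(0)=0$, $D\pi(0)=I$ for every admissible triple, then $\phi$ satisfies C1. 3. If there are $\beta,\rho$ for which D1, D3, D5, D6 hold, then $\phi$ satisfies C2. -/

import Mathlib

open scoped Manifold ContDiff Topology

noncomputable section

namespace NewtonParam

/-! ### Euclidean calculus -/

/-- `ℝⁿ` with the Euclidean norm. -/
abbrev Euc (n : ℕ) : Type := EuclideanSpace ℝ (Fin n)

/-- `ℝⁿ⁺ᵏ` with the Euclidean norm. -/
abbrev Amb (n k : ℕ) : Type := Euc (n + k)

/-- The point `(u, v)` of `ℝⁿ⁺ᵏ`. -/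
def pt {n k : ℕ} (u : Euc n) (v : Euc k) : Amb n k :=
  WithLp.toLp 2 (Fin.append (fun j => u j) (fun j => v j))

/-- The first `n` coordinates of a point of `ℝⁿ⁺ᵏ`. -/
def firstPart {n k : ℕ} (q : Amb n k) : Euc n :=
  WithLp.toLp 2 fun j => q (Fin.castAdd k j)

/-- `J y = (y, 0)`. -/
def J {n k : ℕ} (y : Euc n) : Amb n k := pt y 0

section SecondDerivative

variable {E F : Type*} [NormedAddCommGroup E] [NormedSpace ℝ E]
  [NormedAddCommGroup F] [NormedSpace ℝ F]

/-- `D²f(x)` exists: `f` is differentiable near `x` and `Df` is differentiable at `x`. -/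
def HasD2At (f : E → F) (x : E) : Prop :=
  (∀ᶠ y in 𝓝 x, DifferentiableAt ℝ f y) ∧ DifferentiableAt ℝ (fderiv ℝ f) x

/-- `‖D²f(x)‖ = sup_{‖η‖ = 1} ‖D²f(x)·(η, η)‖`. -/
def normD2 (f : E → F) (x : E) : ℝ :=
  sSup ((fun η : E => ‖fderiv ℝ (fderiv ℝ f) x η η‖) '' Metric.sphere 0 1)

end SecondDerivative

/-! ### Conditions C1 and C2 for maps `TM → M` -/

section Conditions

variable {n : ℕ} {M : Type*} [TopologicalSpace M] [ChartedSpace (Euc n) M]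

/-- The inverse of the chart `τ_φ(v_p) = (φ(p), Dφ(p)·v_p)` of `TM` induced by a chart `φ` of `M`;
it is meaningful for `x ∈ φ.target`. -/
def tauInv (φ : OpenPartialHomeomorph M (Euc n)) (x y : Euc n) : TangentBundle (𝓡 n) M :=
  ⟨φ.symm x, mfderiv (𝓡 n) (𝓡 n) φ.symm x y⟩

/-- The local coordinate representation `φ ∘ f ∘ τ_φ⁻¹` of `f : TM → M`, meaningful on
`localDom φ f`. -/
def localRep (φ : OpenPartialHomeomorph M (Euc n)) (f : TangentBundle (𝓡 n) M → M)
    (x y : Euc n) : Euc n :=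
  φ (f (tauInv φ x y))

/-- The domain of definition of `φ ∘ f ∘ τ_φ⁻¹`. -/
def localDom (φ : OpenPartialHomeomorph M (Euc n)) (f : TangentBundle (𝓡 n) M → M) :
    Set (Euc n × Euc n) :=
  {q | q.1 ∈ φ.target ∧ f (tauInv φ q.1 q.2) ∈ φ.source}

/-- Each slice `{y | (x, y) ∈ dom}` with `‖x‖ < ρ` contains a ball about `0`. -/
def SliceDom (dom : Set (Euc n × Euc n)) (ρ : ℝ) : Prop :=
  ∀ x ∈ Metric.ball (0 : Euc n) ρ, ∃ δ > 0, ∀ y ∈ Metric.ball (0 : Euc n) δ, (x, y) ∈ dom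

/-- Property H1 with radius `ρ` of a partially defined map `h` with domain `dom`:
`h_x(0) = x` and `Dh_x(0) = I`. -/
def H1 (dom : Set (Euc n × Euc n)) (h : Euc n → Euc n → Euc n) (ρ : ℝ) : Prop :=
  SliceDom dom ρ ∧ ∀ x ∈ Metric.ball (0 : Euc n) ρ,
    h x 0 = x ∧ HasFDerivAt (h x) (ContinuousLinearMap.id ℝ (Euc n)) 0

/-- Property H2 with radius `ρ`: `D²h_x(0)` exists and is bounded uniformly in `x`. -/
def H2 (dom : Set (Euc n × Euc n)) (h : Euc n → Euc n → Euc n) (ρ : ℝ) : Prop :=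
  SliceDom dom ρ ∧ ∃ α : ℝ, ∀ x ∈ Metric.ball (0 : Euc n) ρ,
    HasD2At (h x) 0 ∧ normD2 (h x) 0 ≤ α

/-- Property H3 with radius `ρ`: `‖h_x(y) - x - y‖ ≤ β ‖y‖²`. -/
def H3 (dom : Set (Euc n × Euc n)) (h : Euc n → Euc n → Euc n) (ρ : ℝ) : Prop :=
  Metric.ball (0 : Euc n) ρ ×ˢ Metric.ball (0 : Euc n) ρ ⊆ dom ∧
    ∃ β : ℝ, ∀ x ∈ Metric.ball (0 : Euc n) ρ, ∀ y ∈ Metric.ball (0 : Euc n) ρ,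
      ‖h x y - x - y‖ ≤ β * ‖y‖ ^ 2

/-- `φ` is a `C²`-chart of `M` about `p` with `φ(p) = 0`. -/
def IsC2ChartAt (φ : OpenPartialHomeomorph M (Euc n)) (p : M) : Prop :=
  φ ∈ IsManifold.maximalAtlas (𝓡 n) 2 M ∧ p ∈ φ.source ∧ φ p = 0

/-- C1 in the chart `φ` with radius `ρ`. -/
def C1In (φ : OpenPartialHomeomorph M (Euc n)) (ρ : ℝ)
    (f : TangentBundle (𝓡 n) M → M) : Prop :=
  H1 (localDom φ f) (localRep φ f) ρ ∧ H2 (localDom φ f) (localRep φ f) ρ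

/-- C2 in the chart `φ` with radius `ρ`. -/
def C2In (φ : OpenPartialHomeomorph M (Euc n)) (ρ : ℝ)
    (g : TangentBundle (𝓡 n) M → M) : Prop :=
  H3 (localDom φ g) (localRep φ g) ρ

/-- `f` and `g` satisfy C1 and C2, respectively, about every point with a common chart. -/
def ConditionsC1C2 (f g : TangentBundle (𝓡 n) M → M) : Prop :=
  ∀ p : M, ∃ φ : OpenPartialHomeomorph M (Euc n), IsC2ChartAt φ p ∧
    ∃ ρ > 0, C1In φ ρ f ∧ C2In φ ρ g

/-- `f` satisfies C1. -/
def ConditionC1 (f : TangentBundle (𝓡 n) M → M) : Prop :=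
  ∀ p : M, ∃ φ : OpenPartialHomeomorph M (Euc n), IsC2ChartAt φ p ∧ ∃ ρ > 0, C1In φ ρ f

/-- `g` satisfies C2. -/
def ConditionC2 (g : TangentBundle (𝓡 n) M → M) : Prop :=
  ∀ p : M, ∃ φ : OpenPartialHomeomorph M (Euc n), IsC2ChartAt φ p ∧ ∃ ρ > 0, C2In φ ρ g

end Conditions

/-! ### Re-centring: local graphs -/

/-- The class `𝔥_δ`; only the values of `h` on the ball matter. -/
structure IsGraphFun {n k : ℕ} (δ : ℝ) (h : Euc n → Euc k) : Prop where
  contDiffOn : ContDiffOn ℝ 2 h (Metric.ball 0 δ)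
  map_zero : h 0 = 0
  deriv_zero : fderiv ℝ h 0 = 0
  bdd : BddAbove (normD2 h '' Metric.ball 0 δ)

/-- `K = sup_{‖t‖ < δ} ‖D²h(t)‖`. -/
def curvBound {n k : ℕ} (δ : ℝ) (h : Euc n → Euc k) : ℝ :=
  sSup (normD2 h '' Metric.ball 0 δ)

/-- The graph `{(t, h(t)) | ‖t‖ < δ}` in `ℝⁿ⁺ᵏ`. -/
def graphSet {n k : ℕ} (δ : ℝ) (h : Euc n → Euc k) : Set (Amb n k) :=
  (fun t => pt t (h t)) '' Metric.ball 0 δ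

section Recentring

variable {n k : ℕ} {M : Type*} [TopologicalSpace M] [ChartedSpace (Euc n) M]

/-- The derivative of `i` at `x`, with the tangent spaces of `M` and `ℝⁿ⁺ᵏ` written as the model
vector spaces that they are by definition. -/
def tangentPush (i : M → Amb n k) (x : M) : Euc n →L[ℝ] Amb n k :=
  mfderiv (𝓡 n) (𝓡 (n + k)) i x

/-- The tangent space of `i(M)` at `i(x)` as a subset of `ℝⁿ⁺ᵏ`. -/
def tangentPlane (i : M → Amb n k) (x : M) : Set (Amb n k) :=
  Set.range (tangentPush i x)

/-- `R_x` is, for each `x`, a rotation of `ℝⁿ⁺ᵏ` sending the tangent plane at `x` to `ℝⁿ × {0}`. -/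
def IsRotationFamily (i : M → Amb n k) (R : M → (Amb n k ≃ₗᵢ[ℝ] Amb n k)) : Prop :=
  ∀ x : M, LinearMap.det ((R x).toLinearEquiv : Amb n k →ₗ[ℝ] Amb n k) = 1 ∧
    R x '' tangentPlane i x = Set.range (J : Euc n → Amb n k)

/-- The re-centring map `q ↦ R_x (q - i(x))` of `ℝⁿ⁺ᵏ`. -/
def recentre (i : M → Amb n k) (R : M → (Amb n k ≃ₗᵢ[ℝ] Amb n k)) (x : M) (q : Amb n k) :
    Amb n k :=
  R x (q - i x)

/-- The re-centred copy of `i(M)` locally looks like the graph of `h` over the ball of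
radius `δ`. -/
def LocallyLooksLike (i : M → Amb n k) (R : M → (Amb n k ≃ₗᵢ[ℝ] Amb n k)) (x : M)
    (δ : ℝ) (h : Euc n → Euc k) : Prop :=
  ∃ U : Set (Amb n k), IsOpen U ∧ recentre i R x '' Set.range i ∩ U = graphSet δ h

/-- For `w` in the tangent plane at `i(x)`, the vector of `T_xM` whose push-forward under `i`
is `w`; it is unique since `i` is an immersion. -/
def tangentLift (i : M → Amb n k) (x : M) (w : Amb n k) : Euc n :=
  Function.invFun (tangentPush i x) w

/-- `f` in extrinsic coordinates: the point `i(f(v))` for `v ∈ T_xM` with push-forward `w`. -/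
def extrinsic (i : M → Amb n k) (f : TangentBundle (𝓡 n) M → M) (x : M) (w : Amb n k) :
    Amb n k :=
  i (f ⟨x, tangentLift i x w⟩)

/-- The point `R_x Q_x f̂(x, R_x⁻¹ J y)`. -/
def recentredParam (i : M → Amb n k) (R : M → (Amb n k ≃ₗᵢ[ℝ] Amb n k))
    (f : TangentBundle (𝓡 n) M → M) (x : M) (y : Euc n) : Amb n k :=
  recentre i R x (extrinsic i f x ((R x).symm (J y)))

/-- The domain of `π`: the points `y` for which `(π(y), h(π(y))) = R_x Q_x f̂(x, R_x⁻¹ J y)` has a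
solution `π(y)` in the ball of radius `δ`. -/
def piDom (i : M → Amb n k) (R : M → (Amb n k ≃ₗᵢ[ℝ] Amb n k))
    (f : TangentBundle (𝓡 n) M → M) (x : M) (δ : ℝ) (h : Euc n → Euc k) : Set (Euc n) :=
  {y | recentredParam i R f x y ∈ graphSet δ h}

/-- The map `π`; its values are meaningful on `piDom`, where the solution is the first component. -/
def piMap (i : M → Amb n k) (R : M → (Amb n k ≃ₗᵢ[ℝ] Amb n k))
    (f : TangentBundle (𝓡 n) M → M) (x : M) (y : Euc n) : Euc n :=
  firstPart (recentredParam i R f x y)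

/-- The triples `(x, δ, h)` over which condition D quantifies. -/
def Admissible (i : M → Amb n k) (R : M → (Amb n k ≃ₗᵢ[ℝ] Amb n k)) (x : M)
    (δ : ℝ) (h : Euc n → Euc k) : Prop :=
  0 < δ ∧ IsGraphFun δ h ∧ LocallyLooksLike i R x δ h

variable (i : M → Amb n k) (R : M → (Amb n k ≃ₗᵢ[ℝ] Amb n k)) (f : TangentBundle (𝓡 n) M → M)

/-- The domain of `π` contains the ball of radius `ρ(δ, K)`. -/
def D1 (ρ : ℝ → ℝ → ℝ) : Prop :=
  ∀ (x : M) (δ : ℝ) (h : Euc n → Euc k), Admissible i R x δ h →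
    Metric.ball 0 (ρ δ (curvBound δ h)) ⊆ piDom i R f x δ h

/-- `D²π(0)` exists and `‖D²π(0)‖ ≤ α(δ, K)`. -/
def D2 (α : ℝ → ℝ → ℝ) : Prop :=
  ∀ (x : M) (δ : ℝ) (h : Euc n → Euc k), Admissible i R x δ h →
    HasD2At (piMap i R f x) 0 ∧ normD2 (piMap i R f x) 0 ≤ α δ (curvBound δ h)

/-- `‖π(y) - y‖ ≤ β(δ, K) ‖y‖²` on the ball of radius `ρ(δ, K)`. -/
def D3 (β ρ : ℝ → ℝ → ℝ) : Prop :=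
  ∀ (x : M) (δ : ℝ) (h : Euc n → Euc k), Admissible i R x δ h →
    ∀ y ∈ Metric.ball (0 : Euc n) (ρ δ (curvBound δ h)),
      ‖piMap i R f x y - y‖ ≤ β δ (curvBound δ h) * ‖y‖ ^ 2

/-- `π(0) = 0` and `Dπ(0) = I` for every admissible triple. -/
def PiFirstOrder : Prop :=
  ∀ (x : M) (δ : ℝ) (h : Euc n → Euc k), Admissible i R x δ h →
    piMap i R f x 0 = 0 ∧ HasFDerivAt (piMap i R f x) (ContinuousLinearMap.id ℝ (Euc n)) 0

end Recentring

/-- `sup_{K ∈ [0, K̄]} γ(δ, K) < ∞` for all `δ > 0` and `K̄ ≥ 0`; this is D4 for `γ = α` and D5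
for `γ = β`. -/
def LocBddAbove (γ : ℝ → ℝ → ℝ) : Prop :=
  ∀ δ > 0, ∀ Kbar ≥ 0, BddAbove (γ δ '' Set.Icc 0 Kbar)

/-- D6: `inf_{K ∈ [0, K̄]} ρ(δ, K) > 0` for all `δ > 0` and `K̄ ≥ 0`. -/
def LocBddBelowPos (ρ : ℝ → ℝ → ℝ) : Prop :=
  ∀ δ > 0, ∀ Kbar ≥ 0, ∃ c > 0, ∀ K ∈ Set.Icc 0 Kbar, c ≤ ρ δ K

section ConditionD

variable {n k : ℕ} {M : Type*} [TopologicalSpace M] [ChartedSpace (Euc n) M]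
  (i : M → Amb n k) (R : M → (Amb n k ≃ₗᵢ[ℝ] Amb n k)) (f : TangentBundle (𝓡 n) M → M)

/-- Condition D, that is, D1 to D6. The functions `α, β, ρ` are only used at `δ > 0`, `K ≥ 0`. -/
def ConditionD : Prop :=
  ∃ α β ρ : ℝ → ℝ → ℝ, D1 i R f ρ ∧ D2 i R f α ∧ D3 i R f β ρ ∧
    LocBddAbove α ∧ LocBddAbove β ∧ LocBddBelowPos ρ

/-- D1, D2, D4 together with `π(0) = 0`, `Dπ(0) = I` and `ρ(δ, K) > 0`. -/
def ConditionDForC1 : Prop :=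
  ∃ α ρ : ℝ → ℝ → ℝ, D1 i R f ρ ∧ D2 i R f α ∧ LocBddAbove α ∧ PiFirstOrder i R f ∧
    ∀ δ > 0, ∀ K ≥ 0, 0 < ρ δ K

/-- D1, D3, D5 and D6. -/
def ConditionDForC2 : Prop :=
  ∃ β ρ : ℝ → ℝ → ℝ, D1 i R f ρ ∧ D3 i R f β ρ ∧ LocBddAbove β ∧ LocBddBelowPos ρ

end ConditionD

end NewtonParam

end

open NewtonParam

/-! Condition D bounds `π` in terms of the graph radius `δ` and the curvature `K` only, while C1 and
C2 ask for bounds uniform over a neighbourhood. It is therefore enough to show that near each point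
the re-centred manifold is a graph with one common `δ` and all curvatures in one interval `[0, K]`;
D4–D6 then give uniform constants.

In a chart about `p` put `G = i ∘ φ⁻¹`. Near the origin `DG` is bounded, Lipschitz and uniformly
bounded below (`exists_immersion_bounds`). For `s` near the origin let `F_s(u)` be the first `n`
coordinates of `R (G u - G s)`, with `R` the rotation at `φ⁻¹(s)`. Since `R` carries the tangent
plane onto `ℝⁿ × {0}`, `DF_s(s)` has the same lower bound as `DG(s)`, whichever rotation was chosen:
no continuity of `x ↦ R_x` is needed. A quantitative inverse function theorem
(`exists_isLocalInverse`) inverts `F_s` by some `w` on a ball of radius independent of `s`, with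
uniform bounds on `Dw` and its Lipschitz constant. The last `k` coordinates of `R (G (w t) - G s)`
form the graph function `h` (`exists_graph`).

With `A = DF_s(s)`, the inverse of `Dw(0)`, the local representative is `y ↦ w (π (A y))`
(`exists_isRecentredChart`). C1 follows by the second-order chain rule at `0`, and C2 by Taylor's
estimate for `w` combined with D3. -/

namespace NewtonParam

/-! ### Inverse function theorem with explicit constants -/

section QuantitativeInverse

variable {E : Type*} [NormedAddCommGroup E] [NormedSpace ℝ E]

/-- `w` is a `C²` inverse of `F : ball s r → E` over `ball 0 δ`, with `‖Dw‖ ≤ C` and `Dw`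
Lipschitz with constant `L`. -/
structure IsLocalInverse (F w : E → E) (s : E) (r δ C L : ℝ) : Prop where
  mapsTo : ∀ t ∈ Metric.ball (0 : E) δ, w t ∈ Metric.ball s r
  right_inv : ∀ t ∈ Metric.ball (0 : E) δ, F (w t) = t
  left_inv : ∀ u ∈ Metric.ball s r, F u ∈ Metric.ball (0 : E) δ → w (F u) = u
  contDiffOn : ContDiffOn ℝ 2 w (Metric.ball 0 δ)
  norm_fderiv_le : ∀ t ∈ Metric.ball (0 : E) δ, ‖fderiv ℝ w t‖ ≤ C
  comp_fderiv : ∀ t ∈ Metric.ball (0 : E) δ,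
    (fderiv ℝ w t).comp (fderiv ℝ F (w t)) = ContinuousLinearMap.id ℝ E
  lipschitz_fderiv : ∀ t ∈ Metric.ball (0 : E) δ, ∀ t' ∈ Metric.ball (0 : E) δ,
    ‖fderiv ℝ w t - fderiv ℝ w t'‖ ≤ L * ‖t - t'‖

variable [FiniteDimensional ℝ E]

/-- A linear endomorphism of a finite-dimensional space that is bounded below is invertible. -/
theorem exists_continuousLinearEquiv_of_le_norm {A : E →L[ℝ] E} {c : ℝ} (hc : 0 < c)
    (hA : ∀ y, c * ‖y‖ ≤ ‖A y‖) :
    ∃ e : E ≃L[ℝ] E, (e : E →L[ℝ] E) = A ∧ ‖(e.symm : E →L[ℝ] E)‖ ≤ c⁻¹ := by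
  have hinj : Function.Injective (A : E →ₗ[ℝ] E) := by
    rw [injective_iff_map_eq_zero]
    intro y hy
    have h := hA y
    rw [show A y = 0 from hy, norm_zero] at h
    exact norm_eq_zero.1 (le_antisymm (nonpos_of_mul_nonpos_right h hc) (norm_nonneg y))
  let e := (LinearEquiv.ofInjectiveEndo (A : E →ₗ[ℝ] E) hinj).toContinuousLinearEquiv
  have he : (e : E →L[ℝ] E) = A := by ext y; rfl
  refine ⟨e, he, ContinuousLinearMap.opNorm_le_bound _ (by positivity) fun y => ?_⟩
  have h := hA (e.symm y)
  rw [← he] at h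
  simp only [ContinuousLinearEquiv.coe_coe, ContinuousLinearEquiv.apply_symm_apply] at h ⊢
  rwa [← div_eq_inv_mul, le_div_iff₀' hc]

/-- The condition `L * r ≤ c / 2` keeps `DF` within `c / 2` of `DF(s)`, so `F` is a small Lipschitz
perturbation of an isomorphism and `DF` stays bounded below by `c / 2` on the whole ball. All
constants depend on `c, r, L` alone, which makes the result uniform over base points. -/
theorem exists_isLocalInverse {F : E → E} {s : E} {r c L : ℝ} (hr : 0 < r) (hc : 0 < c)
    (hF : ContDiffOn ℝ 2 F (Metric.ball s r)) (hFs : F s = 0)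
    (hlip : ∀ u ∈ Metric.ball s r, ∀ v ∈ Metric.ball s r,
      ‖fderiv ℝ F u - fderiv ℝ F v‖ ≤ L * ‖u - v‖)
    (hL : 0 ≤ L) (hLr : L * r ≤ c / 2) (hlow : ∀ y, c * ‖y‖ ≤ ‖fderiv ℝ F s y‖) :
    ∃ w : E → E, IsLocalInverse F w s r (c * r / 4) (2 / c) (L * (2 / c) ^ 3) := by
  have : CompleteSpace E := FiniteDimensional.complete ℝ E
  have hs : s ∈ Metric.ball s r := Metric.mem_ball_self hr
  have hdiff : ∀ u ∈ Metric.ball s r, ContDiffAt ℝ 2 F u := fun u hu =>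
    hF.contDiffAt (Metric.isOpen_ball.mem_nhds hu)
  have hclose : ∀ u ∈ Metric.ball s r, ‖fderiv ℝ F u - fderiv ℝ F s‖ ≤ c / 2 := fun u hu => by
    refine (hlip u hu s hs).trans (le_trans ?_ hLr)
    gcongr
    exact (mem_ball_iff_norm.1 hu).le
  have hlow' : ∀ u ∈ Metric.ball s r, ∀ y, c / 2 * ‖y‖ ≤ ‖fderiv ℝ F u y‖ := fun u hu y => by
    have h1 : ‖fderiv ℝ F u y - fderiv ℝ F s y‖ ≤ c / 2 * ‖y‖ := by
      rw [← sub_apply]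
      exact ContinuousLinearMap.le_of_opNorm_le _ (hclose u hu) y
    have h2 := norm_sub_norm_le (fderiv ℝ F s y) (fderiv ℝ F u y)
    rw [norm_sub_rev] at h2
    linarith [hlow y]
  obtain ⟨A, hA, hAn⟩ := exists_continuousLinearEquiv_of_le_norm hc hlow
  obtain ⟨κ, hκ⟩ : ∃ κ : NNReal, (κ : ℝ) = c / 2 := ⟨(c / 2).toNNReal, by simp; positivity⟩
  obtain ⟨ν, hν⟩ : ∃ ν : NNReal, (ν : ℝ) = c⁻¹ := ⟨c⁻¹.toNNReal, by simp; positivity⟩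
  have happrox : ApproximatesLinearOn F (A : E →L[ℝ] E) (Metric.ball s r) κ := fun x hx y hy => by
    rw [hA, hκ]
    exact (convex_ball s r).norm_image_sub_le_of_norm_fderiv_le'
      (fun u hu => (hdiff u hu).differentiableAt (by norm_num)) hclose hy hx
  -- In dimension zero the inverse has norm `0` and `0⁻¹ = 0`, so that case is separate.
  have hcN : Subsingleton E ∨ κ < ‖(A.symm : E →L[ℝ] E)‖₊⁻¹ := by
    rcases A.subsingleton_or_nnnorm_symm_pos with h | h
    · exact Or.inl h
    · right
      rw [← NNReal.coe_lt_coe, NNReal.coe_inv, hκ]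
      have h' : (0 : ℝ) < ‖(A.symm : E →L[ℝ] E)‖ := h
      have : c ≤ ‖(A.symm : E →L[ℝ] E)‖⁻¹ := by
        rw [le_inv_comm₀ hc h']; exact hAn
      exact lt_of_lt_of_le (show c / 2 < c by linarith) this
  let e := happrox.toOpenPartialHomeomorph F (Metric.ball s r) hcN Metric.isOpen_ball
  have hsurj : Metric.ball (0 : E) (c * r / 4) ⊆ e.target := by
    -- Recording the bound `c⁻¹` instead of the norm of `A⁻¹` gives the explicit radius `(c - c / 2)
    -- * (r / 2) = c * r / 4`; the closed ball of radius `r / 2` is used because it fits inside the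
    -- open one.
    let N : (A : E →L[ℝ] E).NonlinearRightInverse :=
      { toFun := A.symm
        nnnorm := ν
        bound' := fun y => by rw [hν]; exact ContinuousLinearMap.le_of_opNorm_le _ hAn y
        right_inv' := fun y => A.apply_symm_apply y }
    have h := happrox.surjOn_closedBall_of_nonlinearRightInverse N (half_pos hr).le
      (Metric.closedBall_subset_ball (half_lt_self hr))
    intro t ht
    have hN : ((N.nnnorm : ℝ)⁻¹ - (κ : ℝ)) * (r / 2) = c * r / 4 := by
      rw [show (N.nnnorm : ℝ) = c⁻¹ from hν, hκ, inv_inv]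
      ring
    rw [hN, hFs] at h
    obtain ⟨u, hu, rfl⟩ := h (Metric.ball_subset_closedBall ht)
    exact ⟨u, Metric.closedBall_subset_ball (half_lt_self hr) hu, rfl⟩
  have hmaps : ∀ t ∈ Metric.ball (0 : E) (c * r / 4), e.symm t ∈ Metric.ball s r := fun t ht =>
    e.map_target (hsurj ht)
  have hright : ∀ t ∈ Metric.ball (0 : E) (c * r / 4), F (e.symm t) = t := fun t ht =>
    e.right_inv (hsurj ht)
  have hsymm : ∀ t ∈ Metric.ball (0 : E) (c * r / 4), ContDiffAt ℝ 2 e.symm t ∧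
      (fderiv ℝ F (e.symm t)).comp (fderiv ℝ e.symm t) = ContinuousLinearMap.id ℝ E ∧
      (fderiv ℝ e.symm t).comp (fderiv ℝ F (e.symm t)) = ContinuousLinearMap.id ℝ E ∧
      ‖fderiv ℝ e.symm t‖ ≤ 2 / c := fun t ht => by
    obtain ⟨B, hB, hBn⟩ := exists_continuousLinearEquiv_of_le_norm (half_pos hc)
      (hlow' _ (hmaps t ht))
    have hd : HasFDerivAt e (B : E →L[ℝ] E) (e.symm t) := by
      rw [hB]
      exact ((hdiff _ (hmaps t ht)).differentiableAt (by norm_num)).hasFDerivAt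
    have hw := e.hasFDerivAt_symm (hsurj ht) hd
    rw [hw.fderiv, ← hB]
    refine ⟨e.contDiffAt_symm (hsurj ht) hd (hdiff _ (hmaps t ht)), ?_, ?_, ?_⟩
    · ext y; simp
    · ext y; simp
    · rwa [inv_div] at hBn
  refine ⟨e.symm, hmaps, hright, fun u hu _ => e.left_inv hu,
    fun t ht => (hsymm t ht).1.contDiffWithinAt, fun t ht => (hsymm t ht).2.2.2,
    fun t ht => (hsymm t ht).2.2.1, fun t ht t' ht' => ?_⟩
  have hwlip : ‖e.symm t' - e.symm t‖ ≤ 2 / c * ‖t' - t‖ :=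
    (convex_ball (0 : E) (c * r / 4)).norm_image_sub_le_of_norm_fderiv_le
      (fun u hu => (hsymm u hu).1.differentiableAt (by norm_num))
      (fun u hu => (hsymm u hu).2.2.2) ht ht'
  -- Resolvent identity `P⁻¹ - Q⁻¹ = P⁻¹ (Q - P) Q⁻¹`. The outer factors and the Lipschitz bound for
  -- the inverse each contribute `2 / c`, hence the cube.
  have hid : fderiv ℝ e.symm t - fderiv ℝ e.symm t' =
      ((fderiv ℝ e.symm t).comp (fderiv ℝ F (e.symm t') - fderiv ℝ F (e.symm t))).comp
        (fderiv ℝ e.symm t') := by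
    rw [ContinuousLinearMap.comp_sub, ContinuousLinearMap.sub_comp, (hsymm t ht).2.2.1,
      ContinuousLinearMap.comp_assoc, (hsymm t' ht').2.1]
    rfl
  have h2c : 0 ≤ 2 / c := by positivity
  calc ‖fderiv ℝ e.symm t - fderiv ℝ e.symm t'‖
      ≤ ‖fderiv ℝ e.symm t‖ * ‖fderiv ℝ F (e.symm t') - fderiv ℝ F (e.symm t)‖ *
          ‖fderiv ℝ e.symm t'‖ := by
        rw [hid]
        refine (ContinuousLinearMap.opNorm_comp_le _ _).trans ?_
        gcongr
        exact ContinuousLinearMap.opNorm_comp_le _ _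
    _ ≤ 2 / c * (L * (2 / c * ‖t' - t‖)) * (2 / c) := by
        gcongr
        · exact (hsymm t ht).2.2.2
        · refine (hlip _ (hmaps t' ht') _ (hmaps t ht)).trans ?_
          gcongr
        · exact (hsymm t' ht').2.2.2
    _ = L * (2 / c) ^ 3 * ‖t - t'‖ := by rw [norm_sub_rev]; ring

end QuantitativeInverse

/-! ### The splitting of the ambient space and rotated tangent planes -/

section Splitting

variable {n k : ℕ}

/-- The projection of `ℝⁿ⁺ᵏ` to the first `n` coordinates, as a continuous linear map. -/
noncomputable def fstCLM (n k : ℕ) : Amb n k →L[ℝ] Euc n :=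
  LinearMap.toContinuousLinearMap
    { toFun := firstPart
      map_add' := fun _ _ => rfl
      map_smul' := fun _ _ => rfl }

/-- The projection of `ℝⁿ⁺ᵏ` to the last `k` coordinates, as a continuous linear map. -/
noncomputable def sndCLM (n k : ℕ) : Amb n k →L[ℝ] Euc k :=
  LinearMap.toContinuousLinearMap
    { toFun := fun q => WithLp.toLp 2 fun j => q (Fin.natAdd n j)
      map_add' := fun _ _ => rfl
      map_smul' := fun _ _ => rfl }

@[simp] theorem fstCLM_apply (q : Amb n k) : fstCLM n k q = firstPart q := rfl

theorem sndCLM_apply (q : Amb n k) (j : Fin k) : sndCLM n k q j = q (Fin.natAdd n j) := rfl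

theorem firstPart_pt (u : Euc n) (v : Euc k) : firstPart (pt u v) = u := by
  ext j; simp [firstPart, pt]

theorem sndCLM_pt (u : Euc n) (v : Euc k) : sndCLM n k (pt u v) = v := by
  ext j; simp [sndCLM_apply, pt]

theorem pt_firstPart_sndCLM (q : Amb n k) : pt (firstPart q) (sndCLM n k q) = q := by
  ext j
  refine Fin.addCases (fun j => ?_) (fun j => ?_) j
  · simp [firstPart, pt]
  · simp [sndCLM_apply, pt]

theorem norm_pt_sq (u : Euc n) (v : Euc k) : ‖(pt u v : Amb n k)‖ ^ 2 = ‖u‖ ^ 2 + ‖v‖ ^ 2 := by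
  simp [EuclideanSpace.norm_sq_eq, pt, Fin.sum_univ_add]

theorem norm_J (u : Euc n) : ‖(J u : Amb n k)‖ = ‖u‖ := by
  have h := norm_pt_sq u (0 : Euc k)
  rw [norm_zero, zero_pow two_ne_zero, add_zero] at h
  exact (sq_eq_sq₀ (norm_nonneg _) (norm_nonneg _)).1 h

theorem norm_fstCLM_le : ‖fstCLM n k‖ ≤ 1 := by
  refine ContinuousLinearMap.opNorm_le_bound _ zero_le_one fun q => ?_
  have h := norm_pt_sq (firstPart q) (sndCLM n k q)
  rw [pt_firstPart_sndCLM] at h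
  rw [one_mul, fstCLM_apply]
  exact le_of_sq_le_sq (by nlinarith [sq_nonneg ‖sndCLM n k q‖]) (norm_nonneg _)

theorem norm_sndCLM_le : ‖sndCLM n k‖ ≤ 1 := by
  refine ContinuousLinearMap.opNorm_le_bound _ zero_le_one fun q => ?_
  have h := norm_pt_sq (firstPart q) (sndCLM n k q)
  rw [pt_firstPart_sndCLM] at h
  rw [one_mul]
  exact le_of_sq_le_sq (by nlinarith [sq_nonneg ‖firstPart q‖]) (norm_nonneg _)

/-- A linear map whose image is rotated onto `ℝⁿ × {0}` is determined by its first part. -/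
theorem rotate_eq_J {T : Euc n →L[ℝ] Amb n k} {S : Amb n k ≃ₗᵢ[ℝ] Amb n k}
    (hS : S '' Set.range T = Set.range (J : Euc n → Amb n k)) (y : Euc n) :
    S (T y) = J (firstPart (S (T y))) := by
  obtain ⟨z, hz⟩ : S (T y) ∈ Set.range (J : Euc n → Amb n k) :=
    hS ▸ Set.mem_image_of_mem _ (Set.mem_range_self y)
  rw [← hz]
  exact congrArg J (firstPart_pt z 0).symm

/-- After rotation the last `k` coordinates vanish, so dropping them loses no length. This transfers
lower bounds from `DG` to `DF_s` independently of the rotation. -/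
theorem norm_firstPart_rotate {T : Euc n →L[ℝ] Amb n k} {S : Amb n k ≃ₗᵢ[ℝ] Amb n k}
    (hS : S '' Set.range T = Set.range (J : Euc n → Amb n k)) (y : Euc n) :
    ‖firstPart (S (T y))‖ = ‖T y‖ := by
  rw [← norm_J (k := k), ← rotate_eq_J hS, S.norm_map]

end Splitting

/-! ### Second derivatives and Lipschitz first derivatives -/

section SecondDerivativeBounds

variable {E F : Type*} [NormedAddCommGroup E] [NormedSpace ℝ E]
  [NormedAddCommGroup F] [NormedSpace ℝ F]

theorem norm_fderiv_fderiv_apply_le (f : E → F) (x η : E) :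
    ‖fderiv ℝ (fderiv ℝ f) x η η‖ ≤ ‖fderiv ℝ (fderiv ℝ f) x‖ * ‖η‖ ^ 2 := by
  rw [pow_two, ← mul_assoc]
  exact ContinuousLinearMap.le_opNorm₂ _ _ _

/-- Nonnegativity of `C` covers dimension zero, where the unit sphere is empty and `sSup ∅ = 0`. -/
theorem normD2_le {f : E → F} {x : E} {C : ℝ} (hC : 0 ≤ C)
    (h : ∀ η, ‖η‖ = 1 → ‖fderiv ℝ (fderiv ℝ f) x η η‖ ≤ C) : normD2 f x ≤ C := by
  refine Real.sSup_le ?_ hC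
  rintro _ ⟨η, hη, rfl⟩
  exact h η (mem_sphere_zero_iff_norm.1 hη)

theorem normD2_nonneg (f : E → F) (x : E) : 0 ≤ normD2 f x := by
  refine Real.sSup_nonneg ?_
  rintro _ ⟨η, -, rfl⟩
  exact norm_nonneg _

/-- Homogeneity of degree two. Only diagonal values `(η, η)` occur, so no polarisation is needed. -/
theorem norm_fderiv_fderiv_apply_le_normD2 (f : E → F) (x η : E) :
    ‖fderiv ℝ (fderiv ℝ f) x η η‖ ≤ normD2 f x * ‖η‖ ^ 2 := by
  rcases eq_or_ne η 0 with rfl | hη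
  · simp
  have hpos : 0 < ‖η‖ := norm_pos_iff.2 hη
  have hbdd : BddAbove ((fun η : E => ‖fderiv ℝ (fderiv ℝ f) x η η‖) '' Metric.sphere 0 1) := by
    refine ⟨‖fderiv ℝ (fderiv ℝ f) x‖, ?_⟩
    rintro _ ⟨ζ, hζ, rfl⟩
    simpa [mem_sphere_zero_iff_norm.1 hζ] using norm_fderiv_fderiv_apply_le f x ζ
  have h := le_csSup hbdd (Set.mem_image_of_mem _
    (show ‖η‖⁻¹ • η ∈ Metric.sphere (0 : E) 1 by
      simp [norm_smul, hpos.ne']))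
  simp only [map_smul, smul_apply, norm_smul, norm_inv, norm_norm] at h
  change _ ≤ normD2 f x at h
  rw [← mul_assoc, ← mul_inv, ← pow_two, ← div_eq_inv_mul, div_le_iff₀ (by positivity)] at h
  exact h

theorem normD2_le_of_lipschitz {f : E → F} {s : Set E} (hs : IsOpen s) {C : ℝ} (hC : 0 ≤ C)
    (h : ∀ t ∈ s, ∀ t' ∈ s, ‖fderiv ℝ f t - fderiv ℝ f t'‖ ≤ C * ‖t - t'‖) {t : E} (ht : t ∈ s) :
    normD2 f t ≤ C := by
  refine normD2_le hC fun η hη => ?_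
  have h1 : ‖fderiv ℝ (fderiv ℝ f) t‖ ≤ C :=
    norm_fderiv_le_of_lip' ℝ hC
      (Filter.eventually_of_mem (hs.mem_nhds ht) fun t' ht' => h t' ht' t ht)
  simpa [hη] using (norm_fderiv_fderiv_apply_le f t η).trans
    (mul_le_mul_of_nonneg_right h1 (by positivity))

/-- First-order Taylor estimate for a map with Lipschitz derivative. -/
theorem norm_sub_fderiv_zero_le {f : E → F} {δ L : ℝ} (hL : 0 ≤ L)
    (hf : ∀ t ∈ Metric.ball (0 : E) δ, DifferentiableAt ℝ f t)
    (h : ∀ t ∈ Metric.ball (0 : E) δ, ∀ t' ∈ Metric.ball (0 : E) δ,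
      ‖fderiv ℝ f t - fderiv ℝ f t'‖ ≤ L * ‖t - t'‖) {t : E} (ht : t ∈ Metric.ball (0 : E) δ) :
    ‖f t - f 0 - fderiv ℝ f 0 t‖ ≤ L * ‖t‖ ^ 2 := by
  have hδ : 0 < δ := (norm_nonneg t).trans_lt (mem_ball_zero_iff.1 ht)
  have hsub : ∀ u ∈ Metric.closedBall (0 : E) ‖t‖, u ∈ Metric.ball (0 : E) δ := fun u hu =>
    mem_ball_zero_iff.2 ((mem_closedBall_zero_iff.1 hu).trans_lt (mem_ball_zero_iff.1 ht))
  have key := (convex_closedBall (0 : E) ‖t‖).norm_image_sub_le_of_norm_fderiv_le'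
    (f := f) (φ := fderiv ℝ f 0) (C := L * ‖t‖) (x := 0) (y := t)
    (fun u hu => hf u (hsub u hu))
    (fun u hu => by
      refine (h u (hsub u hu) 0 (Metric.mem_ball_self hδ)).trans ?_
      rw [sub_zero]
      gcongr
      exact mem_closedBall_zero_iff.1 hu)
    (Metric.mem_closedBall_self (norm_nonneg _)) (by simp)
  rw [sub_zero] at key
  linarith [key, show L * ‖t‖ * ‖t‖ = L * ‖t‖ ^ 2 by ring]

end SecondDerivativeBounds

/-! ### Images of immersions as graphs with controlled curvature -/

section Graph

variable {n k : ℕ}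

theorem curvBound_nonneg (δ : ℝ) (h : Euc n → Euc k) : 0 ≤ curvBound δ h := by
  refine Real.sSup_nonneg ?_
  rintro _ ⟨t, -, rfl⟩
  exact normD2_nonneg h t

theorem fderiv_firstPart_rotate {G : Euc n → Amb n k} {u : Euc n} (hG : DifferentiableAt ℝ G u)
    (S : Amb n k ≃ₗᵢ[ℝ] Amb n k) (q : Amb n k) :
    fderiv ℝ (fun v => firstPart (S (G v - q))) u =
      ((fstCLM n k).comp (S : Amb n k →L[ℝ] Amb n k)).comp (fderiv ℝ G u) :=
  (((fstCLM n k).comp (S : Amb n k →L[ℝ] Amb n k)).hasFDerivAt.comp u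
    (hG.hasFDerivAt.sub_const q)).fderiv

/-- Near a point at which an immersion `G` has tangent plane rotated onto `ℝⁿ × {0}`, the image of
`G` is a graph over a ball, with radius and curvature controlled by bounds for `G`. -/
theorem exists_graph {G : Euc n → Amb n k} {s : Euc n} {r c L C : ℝ} (hr : 0 < r) (hc : 0 < c)
    (hL : 0 ≤ L) (hC : 0 ≤ C) (hG : ContDiffOn ℝ 2 G (Metric.ball s r))
    (hlip : ∀ u ∈ Metric.ball s r, ∀ v ∈ Metric.ball s r,
      ‖fderiv ℝ G u - fderiv ℝ G v‖ ≤ L * ‖u - v‖)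
    (hbd : ∀ u ∈ Metric.ball s r, ‖fderiv ℝ G u‖ ≤ C)
    (hLr : L * r ≤ c / 2) (hlow : ∀ y, c * ‖y‖ ≤ ‖fderiv ℝ G s y‖)
    {S : Amb n k ≃ₗᵢ[ℝ] Amb n k}
    (hS : S '' Set.range (fderiv ℝ G s) = Set.range (J : Euc n → Amb n k)) :
    ∃ (w : Euc n → Euc n) (h : Euc n → Euc k),
      IsLocalInverse (fun u => firstPart (S (G u - G s))) w s r (c * r / 4) (2 / c)
        (L * (2 / c) ^ 3) ∧
      IsGraphFun (c * r / 4) h ∧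
      curvBound (c * r / 4) h ∈ Set.Icc 0 (L * (2 / c) ^ 2 + C * (L * (2 / c) ^ 3)) ∧
      ∀ t ∈ Metric.ball (0 : Euc n) (c * r / 4), S (G (w t) - G s) = pt t (h t) := by
  have hGd : ∀ u ∈ Metric.ball s r, ContDiffAt ℝ 2 G u := fun u hu =>
    hG.contDiffAt (Metric.isOpen_ball.mem_nhds hu)
  have hGdiff : ∀ u ∈ Metric.ball s r, DifferentiableAt ℝ G u := fun u hu =>
    (hGd u hu).differentiableAt (by norm_num)
  have hs : s ∈ Metric.ball s r := Metric.mem_ball_self hr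
  have hSn : ‖(S : Amb n k →L[ℝ] Amb n k)‖ ≤ 1 := S.toLinearIsometry.norm_toContinuousLinearMap_le
  have hPS : ‖(fstCLM n k).comp (S : Amb n k →L[ℝ] Amb n k)‖ ≤ 1 :=
    (ContinuousLinearMap.opNorm_comp_le _ _).trans
      (mul_le_one₀ norm_fstCLM_le (norm_nonneg _) hSn)
  let Q : Amb n k →L[ℝ] Euc k := (sndCLM n k).comp (S : Amb n k →L[ℝ] Amb n k)
  have hQ : ‖Q‖ ≤ 1 := (ContinuousLinearMap.opNorm_comp_le _ _).trans
      (mul_le_one₀ norm_sndCLM_le (norm_nonneg _) hSn)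
  obtain ⟨w, hw⟩ := exists_isLocalInverse (F := fun u => firstPart (S (G u - G s))) (L := L)
    hr hc
    (((fstCLM n k).comp (S : Amb n k →L[ℝ] Amb n k)).contDiff.comp_contDiffOn
      (hG.sub contDiffOn_const))
    (by rw [sub_self, map_zero]; exact map_zero (fstCLM n k))
    (fun u hu v hv => by
      rw [fderiv_firstPart_rotate (hGdiff u hu), fderiv_firstPart_rotate (hGdiff v hv),
        ← ContinuousLinearMap.comp_sub]
      refine (ContinuousLinearMap.opNorm_comp_le _ _).trans ?_
      refine (mul_le_of_le_one_left (norm_nonneg _) hPS).trans (hlip u hu v hv))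
    hL hLr
    (fun y => by
      rw [fderiv_firstPart_rotate (hGdiff s hs)]
      exact (hlow y).trans_eq (norm_firstPart_rotate hS y).symm)
  set δ := c * r / 4 with hδ
  have hδ0 : 0 < δ := by positivity
  have h0 : (0 : Euc n) ∈ Metric.ball (0 : Euc n) δ := Metric.mem_ball_self hδ0
  have hFs : firstPart (S (G s - G s)) = 0 := by
    rw [sub_self, map_zero]; exact map_zero (fstCLM n k)
  have hw0 : w 0 = s := by
    have := hw.left_inv s hs (by simp only [hFs]; exact h0)
    simpa only [hFs] using this
  have hwd : ∀ t ∈ Metric.ball (0 : Euc n) δ, DifferentiableAt ℝ w t := fun t ht =>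
    (hw.contDiffOn.contDiffAt (Metric.isOpen_ball.mem_nhds ht)).differentiableAt (by norm_num)
  let h : Euc n → Euc k := fun t => Q (G (w t) - G s)
  have hder : ∀ t ∈ Metric.ball (0 : Euc n) δ,
      fderiv ℝ h t = Q.comp ((fderiv ℝ G (w t)).comp (fderiv ℝ w t)) := fun t ht =>
    (Q.hasFDerivAt.comp t (((hGdiff _ (hw.mapsTo t ht)).hasFDerivAt.comp t
      (hwd t ht).hasFDerivAt).sub_const (G s))).fderiv
  have hwlip : ∀ t ∈ Metric.ball (0 : Euc n) δ, ∀ t' ∈ Metric.ball (0 : Euc n) δ,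
      ‖w t - w t'‖ ≤ 2 / c * ‖t - t'‖ := fun t ht t' ht' =>
    (convex_ball (0 : Euc n) δ).norm_image_sub_le_of_norm_fderiv_le hwd hw.norm_fderiv_le ht' ht
  have hlipD : ∀ t ∈ Metric.ball (0 : Euc n) δ, ∀ t' ∈ Metric.ball (0 : Euc n) δ,
      ‖fderiv ℝ h t - fderiv ℝ h t'‖ ≤
        (L * (2 / c) ^ 2 + C * (L * (2 / c) ^ 3)) * ‖t - t'‖ := fun t ht t' ht' => by
    -- Inserting `DG(w t') ∘ Dw(t)` separates the variation of `DG` from that of `Dw`, giving the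
    -- two terms of the curvature bound.
    have hsplit : fderiv ℝ h t - fderiv ℝ h t' =
        Q.comp ((fderiv ℝ G (w t) - fderiv ℝ G (w t')).comp (fderiv ℝ w t) +
          (fderiv ℝ G (w t')).comp (fderiv ℝ w t - fderiv ℝ w t')) := by
      rw [hder t ht, hder t' ht', ContinuousLinearMap.sub_comp, ContinuousLinearMap.comp_sub,
        ← ContinuousLinearMap.comp_sub]
      congr 1
      abel
    rw [hsplit]
    refine (ContinuousLinearMap.opNorm_comp_le _ _).trans ?_
    refine (mul_le_of_le_one_left (norm_nonneg _) hQ).trans ?_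
    refine (norm_add_le _ _).trans ?_
    have e1 : ‖(fderiv ℝ G (w t) - fderiv ℝ G (w t')).comp (fderiv ℝ w t)‖ ≤
        L * (2 / c * ‖t - t'‖) * (2 / c) := by
      refine (ContinuousLinearMap.opNorm_comp_le _ _).trans ?_
      gcongr
      · refine (hlip _ (hw.mapsTo t ht) _ (hw.mapsTo t' ht')).trans ?_
        gcongr
        exact hwlip t ht t' ht'
      · exact hw.norm_fderiv_le t ht
    have e2 : ‖(fderiv ℝ G (w t')).comp (fderiv ℝ w t - fderiv ℝ w t')‖ ≤
        C * (L * (2 / c) ^ 3 * ‖t - t'‖) := by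
      refine (ContinuousLinearMap.opNorm_comp_le _ _).trans ?_
      gcongr
      · exact hbd _ (hw.mapsTo t' ht')
      · exact hw.lipschitz_fderiv t ht t' ht'
    linarith
  have hcurv : ∀ t ∈ Metric.ball (0 : Euc n) δ,
      normD2 h t ≤ L * (2 / c) ^ 2 + C * (L * (2 / c) ^ 3) := fun t ht =>
    normD2_le_of_lipschitz Metric.isOpen_ball (by positivity) hlipD ht
  refine ⟨w, h, hw, ⟨?_, ?_, ?_, ?_⟩, ⟨?_, ?_⟩, fun t ht => ?_⟩
  · exact Q.contDiff.comp_contDiffOn ((hG.comp hw.contDiffOn hw.mapsTo).sub contDiffOn_const)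
  · change Q (G (w 0) - G s) = 0
    rw [hw0, sub_self, map_zero]
  -- `Dh(0) = 0` because the image of `DG(s)` is rotated into `ℝⁿ × {0}`.
  · rw [hder 0 h0, hw0]
    ext1 y
    change sndCLM n k (S (fderiv ℝ G s (fderiv ℝ w 0 y))) = 0
    rw [rotate_eq_J hS, J, sndCLM_pt]
  · refine ⟨L * (2 / c) ^ 2 + C * (L * (2 / c) ^ 3), ?_⟩
    rintro _ ⟨t, ht, rfl⟩
    exact hcurv t ht
  · exact curvBound_nonneg _ h
  · refine Real.sSup_le ?_ (by positivity)
    rintro _ ⟨t, ht, rfl⟩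
    exact hcurv t ht
  · rw [← pt_firstPart_sndCLM (S (G (w t) - G s)), hw.right_inv t ht]
    rfl

end Graph

/-! ### Charts, immersions and local parametrisations -/

section Charts

variable {n k : ℕ} {M : Type*} [TopologicalSpace M] [ChartedSpace (Euc n) M]

theorem exists_isC2ChartAt [IsManifold (𝓡 n) 2 M] (p : M) :
    ∃ φ : OpenPartialHomeomorph M (Euc n), IsC2ChartAt φ p := by
  let e := chartAt (Euc n) p
  refine ⟨e.transHomeomorph (Homeomorph.subRight (e p)), ?_, mem_chart_source (Euc n) p, ?_⟩
  · refine OpenPartialHomeomorph.mem_maximalAtlas_of_contMDiffOn _ ?_ ?_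
    · have h : ContMDiff (𝓡 n) (𝓡 n) 2 (fun u : Euc n => u - e p) :=
        (contDiff_id.sub contDiff_const).contMDiff
      exact h.comp_contMDiffOn contMDiffOn_chart
    · have h : ContMDiff (𝓡 n) (𝓡 n) 2 (fun u : Euc n => u + e p) :=
        (contDiff_id.add contDiff_const).contMDiff
      exact contMDiffOn_chart_symm.comp h.contMDiffOn (fun u hu => by simpa using hu)
  · exact sub_self (e p)

/-- In immersion charts `i` is a linear inclusion, so projecting away the complement yields a
differentiable local left inverse `ℓ`; the chain rule for `ℓ ∘ i = id` concludes. -/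
theorem tangentPush_injective {i : M → Amb n k}
    (hi : Manifold.IsImmersion (𝓡 n) (𝓡 (n + k)) 2 i) (x : M) :
    Function.Injective (tangentPush i x) := by
  have hx := hi.isImmersionAt x
  let P : Amb n k →L[ℝ] Euc n :=
    (ContinuousLinearMap.fst ℝ (Euc n) hx.complement).comp (hx.equiv.symm : Amb n k →L[ℝ] _)
  let ℓ : Amb n k → M := hx.domChart.symm ∘ P ∘ hx.codChart
  have hP : ∀ y ∈ hx.domChart.source, P (hx.codChart (i y)) = hx.domChart y := fun y hy => by
    have hmem : hx.domChart y ∈ (hx.domChart.extend (𝓡 n)).target := by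
      simpa using hx.domChart.map_source hy
    have h := hx.writtenInCharts hmem
    simp only [Function.comp_apply, mfld_simps, hx.domChart.left_inv hy] at h
    simp [P, h]
  have hcod : MDifferentiableAt (𝓡 (n + k)) (𝓡 (n + k)) hx.codChart (i x) :=
    (contMDiffAt_of_mem_maximalAtlas hx.codChart_mem_maximalAtlas
      hx.mem_codChart_source).mdifferentiableAt (by norm_num)
  have hmid : MDifferentiableAt (𝓡 (n + k)) (𝓡 n) P (hx.codChart (i x)) :=
    P.differentiableAt.mdifferentiableAt
  have hdom : MDifferentiableAt (𝓡 n) (𝓡 n) hx.domChart.symm (P (hx.codChart (i x))) := by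
    rw [hP x hx.mem_domChart_source]
    exact (contMDiffAt_symm_of_mem_maximalAtlas hx.domChart_mem_maximalAtlas
      (hx.domChart.map_source hx.mem_domChart_source)).mdifferentiableAt (by norm_num)
  have hℓ : MDifferentiableAt (𝓡 (n + k)) (𝓡 n) ℓ (i x) :=
    hdom.comp (i x) (hmid.comp (i x) hcod)
  have hid : ℓ ∘ i =ᶠ[𝓝 x] id := by
    filter_upwards [hx.domChart.open_source.mem_nhds hx.mem_domChart_source] with y hy
    change hx.domChart.symm (P (hx.codChart (i y))) = y
    rw [hP y hy, hx.domChart.left_inv hy]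
  have hcomp := mfderiv_comp x hℓ (hx.contMDiffAt.mdifferentiableAt (by norm_num))
  rw [hid.mfderiv_eq, mfderiv_id] at hcomp
  intro v v' hv
  have hv' := congrArg (mfderiv (𝓡 (n + k)) (𝓡 n) ℓ (i x)) hv
  have h1 := DFunLike.congr_fun hcomp v
  have h2 := DFunLike.congr_fun hcomp v'
  exact (h1.trans hv').trans h2.symm

/-- The local parametrisation `i ∘ φ⁻¹` of `i(M)`. -/
def embParam (i : M → Amb n k) (φ : OpenPartialHomeomorph M (Euc n)) (u : Euc n) : Amb n k :=
  i (φ.symm u)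

variable {i : M → Amb n k} {φ : OpenPartialHomeomorph M (Euc n)}

theorem contDiffOn_embParam (hi : ContMDiff (𝓡 n) (𝓡 (n + k)) 2 i)
    (hφ : φ ∈ IsManifold.maximalAtlas (𝓡 n) 2 M) : ContDiffOn ℝ 2 (embParam i φ) φ.target :=
  contMDiffOn_iff_contDiffOn.1
    (hi.comp_contMDiffOn (contMDiffOn_symm_of_mem_maximalAtlas hφ))

theorem fderiv_embParam_apply (hi : ContMDiff (𝓡 n) (𝓡 (n + k)) 2 i)
    (hφ : φ ∈ IsManifold.maximalAtlas (𝓡 n) 2 M) {s : Euc n} (hs : s ∈ φ.target) (y : Euc n) :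
    fderiv ℝ (embParam i φ) s y =
      tangentPush i (φ.symm s) (mfderiv (𝓡 n) (𝓡 n) φ.symm s y) := by
  have h := mfderiv_comp s ((hi.mdifferentiable (by norm_num)) (φ.symm s))
    ((contMDiffAt_symm_of_mem_maximalAtlas hφ hs).mdifferentiableAt (by norm_num))
  rw [← mfderiv_eq_fderiv]
  exact DFunLike.congr_fun h y

theorem bijective_mfderiv_symm [IsManifold (𝓡 n) 2 M]
    (hφ : φ ∈ IsManifold.maximalAtlas (𝓡 n) 2 M) {s : Euc n}
    (hs : s ∈ φ.target) : Function.Bijective (mfderiv (𝓡 n) (𝓡 n) φ.symm s) := by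
  have hd := (contMDiffAt_of_mem_maximalAtlas hφ (φ.map_target hs)).mdifferentiableAt
    (n := 2) (by norm_num)
  have hds := (contMDiffAt_symm_of_mem_maximalAtlas hφ hs).mdifferentiableAt
    (n := 2) (by norm_num)
  have hinj : Function.Injective (mfderiv (𝓡 n) (𝓡 n) φ.symm s) := by
    have hcomp := mfderiv_comp s hd hds
    have hid : φ ∘ φ.symm =ᶠ[𝓝 s] id := by
      filter_upwards [φ.open_target.mem_nhds hs] with u hu using φ.right_inv hu
    rw [hid.mfderiv_eq, mfderiv_id] at hcomp
    intro v v' hv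
    have hv' := congrArg (mfderiv (𝓡 n) (𝓡 n) φ (φ.symm s)) hv
    exact ((DFunLike.congr_fun hcomp v).trans hv').trans (DFunLike.congr_fun hcomp v').symm
  let T : Euc n →L[ℝ] Euc n := mfderiv (𝓡 n) (𝓡 n) φ.symm s
  exact ⟨hinj, (LinearMap.injective_iff_surjective (f := (T : Euc n →ₗ[ℝ] Euc n))).1 hinj⟩

theorem range_fderiv_embParam [IsManifold (𝓡 n) 2 M] (hi : ContMDiff (𝓡 n) (𝓡 (n + k)) 2 i)
    (hφ : φ ∈ IsManifold.maximalAtlas (𝓡 n) 2 M) {s : Euc n} (hs : s ∈ φ.target) :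
    Set.range (fderiv ℝ (embParam i φ) s) = tangentPlane i (φ.symm s) := by
  ext q
  constructor
  · rintro ⟨y, rfl⟩
    exact ⟨_, (fderiv_embParam_apply hi hφ hs y).symm⟩
  · rintro ⟨v, rfl⟩
    obtain ⟨y, rfl⟩ := (bijective_mfderiv_symm hφ hs).2 v
    exact ⟨y, fderiv_embParam_apply hi hφ hs y⟩

/-- Bounds for an immersion in a neighbourhood of a point. -/
theorem exists_immersion_bounds {G : Euc n → Amb n k} {U : Set (Euc n)} (hU : IsOpen U)
    (h0 : (0 : Euc n) ∈ U) (hG : ContDiffOn ℝ 2 G U)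
    (hinj : Function.Injective (fderiv ℝ G 0)) :
    ∃ r > 0, ∃ c > 0, ∃ L ≥ 0, ∃ C ≥ 0, L * r ≤ c / 2 ∧ Metric.ball 0 (2 * r) ⊆ U ∧
      (∀ u ∈ Metric.ball (0 : Euc n) (2 * r), ∀ v ∈ Metric.ball (0 : Euc n) (2 * r),
        ‖fderiv ℝ G u - fderiv ℝ G v‖ ≤ L * ‖u - v‖) ∧
      (∀ u ∈ Metric.ball (0 : Euc n) (2 * r), ‖fderiv ℝ G u‖ ≤ C) ∧
      ∀ u ∈ Metric.ball (0 : Euc n) (2 * r), ∀ y, c * ‖y‖ ≤ ‖fderiv ℝ G u y‖ := by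
  obtain ⟨κ, hκ, hanti⟩ := (fderiv ℝ G 0 : Euc n →ₗ[ℝ] Amb n k).exists_antilipschitzWith
    (LinearMap.ker_eq_bot.2 hinj)
  have hκ' : (0 : ℝ) < κ := hκ
  have hlow0 : ∀ y, (κ : ℝ)⁻¹ * ‖y‖ ≤ ‖fderiv ℝ G 0 y‖ := fun y => by
    rw [← div_eq_inv_mul, div_le_iff₀' hκ']
    simpa using hanti.le_mul_dist y 0
  have hD : ContDiffAt ℝ 1 (fderiv ℝ G) 0 :=
    (hG.contDiffAt (hU.mem_nhds h0)).fderiv_right (by norm_num)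
  obtain ⟨L, V, hV, hlip⟩ := hD.exists_lipschitzOnWith
  obtain ⟨ε, hε, hball⟩ := Metric.mem_nhds_iff.1 (Filter.inter_mem hV (hU.mem_nhds h0))
  -- Half the lower bound at `0`: `DG` moves by at most `L * (2 * r) ≤ c`, which leaves `c`. The
  -- radius `2 * r` makes room for `ball s r` for every `s` in `ball 0 r`.
  set c : ℝ := (κ : ℝ)⁻¹ / 2 with hcdef
  have hc : 0 < c := by positivity
  have hL : (0 : ℝ) ≤ L := L.2
  let r : ℝ := min (ε / 2) (c / (2 * (L + 1)))
  have hr : 0 < r := by positivity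
  have hrε : 2 * r ≤ ε := by linarith [min_le_left (ε / 2) (c / (2 * ((L : ℝ) + 1)))]
  have hrc : ((L : ℝ) + 1) * r ≤ c / 2 := by
    have := min_le_right (ε / 2) (c / (2 * ((L : ℝ) + 1)))
    calc ((L : ℝ) + 1) * r ≤ (L + 1) * (c / (2 * ((L : ℝ) + 1))) := by gcongr
      _ = c / 2 := by field_simp
  have hsub : Metric.ball (0 : Euc n) (2 * r) ⊆ V ∩ U :=
    (Metric.ball_subset_ball hrε).trans hball
  have hLr : (L : ℝ) * r ≤ c / 2 := by linarith
  have hlip' : ∀ u ∈ Metric.ball (0 : Euc n) (2 * r), ∀ v ∈ Metric.ball (0 : Euc n) (2 * r),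
      ‖fderiv ℝ G u - fderiv ℝ G v‖ ≤ L * ‖u - v‖ := fun u hu v hv =>
    hlip.norm_sub_le (hsub hu).1 (hsub hv).1
  have hclose : ∀ u ∈ Metric.ball (0 : Euc n) (2 * r), ‖fderiv ℝ G u - fderiv ℝ G 0‖ ≤ c :=
    fun u hu => by
      refine (hlip' u hu 0 (Metric.mem_ball_self (by positivity))).trans ?_
      rw [sub_zero]
      have : (L : ℝ) * ‖u‖ ≤ L * (2 * r) := by
        gcongr
        exact (mem_ball_zero_iff.1 hu).le
      linarith
  refine ⟨r, hr, c, hc, L, hL, ‖fderiv ℝ G 0‖ + c, by positivity, hLr,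
    fun u hu => (hsub hu).2, hlip', fun u hu => ?_, fun u hu y => ?_⟩
  · have := norm_sub_norm_le (fderiv ℝ G u) (fderiv ℝ G 0)
    linarith [hclose u hu]
  · have h1 : ‖fderiv ℝ G u y - fderiv ℝ G 0 y‖ ≤ c * ‖y‖ := by
      rw [← sub_apply]
      exact ContinuousLinearMap.le_of_opNorm_le _ (hclose u hu) y
    have h2 := norm_sub_norm_le (fderiv ℝ G 0 y) (fderiv ℝ G u y)
    rw [norm_sub_rev] at h2
    have h3 := hlow0 y
    have h4 : (κ : ℝ)⁻¹ = c + c := by rw [hcdef]; ring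
    rw [h4, add_mul] at h3
    linarith

end Charts

/-! ### Uniform graph charts and the factorisation through `π` -/

section RecentredCharts

/-- An open piece of the domain of an embedding whose re-centred image is a graph. -/
theorem locallyLooksLike_of_isLocalInverse {n k : ℕ} {M : Type*} [TopologicalSpace M]
    {i : M → Amb n k} {R : M → (Amb n k ≃ₗᵢ[ℝ] Amb n k)}
    {φ : OpenPartialHomeomorph M (Euc n)} (hi : Topology.IsEmbedding i) {s : Euc n}
    {r δ B L : ℝ} {w : Euc n → Euc n} {h : Euc n → Euc k} (hsub : Metric.ball s r ⊆ φ.target)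
    (hcont : ContinuousOn (embParam i φ) (Metric.ball s r))
    (hw : IsLocalInverse (fun u => firstPart (R (φ.symm s) (embParam i φ u - embParam i φ s)))
      w s r δ B L)
    (hh : ∀ t ∈ Metric.ball (0 : Euc n) δ,
      R (φ.symm s) (embParam i φ (w t) - embParam i φ s) = pt t (h t)) :
    LocallyLooksLike i R (φ.symm s) δ h := by
  set F : Euc n → Euc n := fun u =>
    firstPart (R (φ.symm s) (embParam i φ u - embParam i φ s))
  have hFc : ContinuousOn F (Metric.ball s r) :=
    ((fstCLM n k).continuous.comp (R (φ.symm s)).continuous).comp_continuousOn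
      (hcont.sub continuousOn_const)
  have hWo : IsOpen (Metric.ball s r ∩ F ⁻¹' Metric.ball 0 δ) :=
    hFc.isOpen_inter_preimage Metric.isOpen_ball Metric.isOpen_ball
  have hVo : IsOpen (φ.symm '' (Metric.ball s r ∩ F ⁻¹' Metric.ball 0 δ)) :=
    φ.isOpen_image_symm_of_subset_target hWo (Set.inter_subset_left.trans hsub)
  -- Here the embedding topology matters: an ambient open set cuts out exactly this chart piece and
  -- excludes other sheets of `i(M)` passing nearby.
  obtain ⟨U, hU, hUV⟩ := hi.isInducing.isOpen_iff.1 hVo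
  refine ⟨{q | (R (φ.symm s)).symm q + i (φ.symm s) ∈ U},
    hU.preimage ((R (φ.symm s)).symm.continuous.add continuous_const), ?_⟩
  have hmem : ∀ m : M, recentre i R (φ.symm s) (i m) ∈
      {q | (R (φ.symm s)).symm q + i (φ.symm s) ∈ U} ↔
        m ∈ φ.symm '' (Metric.ball s r ∩ F ⁻¹' Metric.ball 0 δ) := fun m => by
    rw [← hUV]
    simp [recentre]
  ext q
  constructor
  · rintro ⟨⟨_, ⟨m, rfl⟩, rfl⟩, hq⟩
    obtain ⟨u, ⟨hu, hut⟩, rfl⟩ := (hmem m).1 hq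
    refine ⟨F u, hut, ?_⟩
    change pt (F u) (h (F u)) = _
    rw [← hh (F u) hut, hw.left_inv u hu hut]
    rfl
  · rintro ⟨t, ht, rfl⟩
    have hq : pt t (h t) = recentre i R (φ.symm s) (i (φ.symm (w t))) := (hh t ht).symm
    change pt t (h t) ∈ _
    rw [hq]
    refine ⟨⟨_, ⟨_, rfl⟩, rfl⟩, (hmem _).2 ⟨w t, ⟨hw.mapsTo t ht, ?_⟩, rfl⟩⟩
    rw [Set.mem_preimage, hw.right_inv t ht]
    exact ht

variable {n k : ℕ} {M : Type*} [TopologicalSpace M] [ChartedSpace (Euc n) M]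

/-- At the point with coordinate `s` in the chart `φ`, the re-centred manifold is the graph of `h`
over the ball of radius `δ`, the transition from the graph coordinate to `φ` is `w`, and the
derivative of the inverse transition at `s` is `A`. -/
structure IsRecentredChart (i : M → Amb n k) (R : M → (Amb n k ≃ₗᵢ[ℝ] Amb n k))
    (φ : OpenPartialHomeomorph M (Euc n)) (s : Euc n) (δ B L K : ℝ) (A : Euc n →L[ℝ] Euc n)
    (w : Euc n → Euc n) (h : Euc n → Euc k) : Prop where
  admissible : Admissible i R (φ.symm s) δ h
  curvBound_mem : curvBound δ h ∈ Set.Icc 0 K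
  contDiffOn : ContDiffOn ℝ 2 w (Metric.ball 0 δ)
  map_zero : w 0 = s
  fderiv_comp : (fderiv ℝ w 0).comp A = ContinuousLinearMap.id ℝ (Euc n)
  norm_le : ‖A‖ ≤ B
  norm_fderiv_le : ‖fderiv ℝ w 0‖ ≤ B
  lipschitz_fderiv : ∀ t ∈ Metric.ball (0 : Euc n) δ, ∀ t' ∈ Metric.ball (0 : Euc n) δ,
    ‖fderiv ℝ w t - fderiv ℝ w t'‖ ≤ L * ‖t - t'‖
  localRep_eq : ∀ (f : TangentBundle (𝓡 n) M → M) (y : Euc n),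
    A y ∈ piDom i R f (φ.symm s) δ h →
      piMap i R f (φ.symm s) (A y) ∈ Metric.ball (0 : Euc n) δ ∧ (s, y) ∈ localDom φ f ∧
        localRep φ f s y = w (piMap i R f (φ.symm s) (A y))

variable {i : M → Amb n k} {R : M → (Amb n k ≃ₗᵢ[ℝ] Amb n k)}

theorem exists_isRecentredChart [IsManifold (𝓡 n) 2 M]
    (hi : Manifold.IsSmoothEmbedding (𝓡 n) (𝓡 (n + k)) 2 i) (hR : IsRotationFamily i R) (p : M) :
    ∃ φ : OpenPartialHomeomorph M (Euc n), IsC2ChartAt φ p ∧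
      ∃ r > 0, ∃ δ > 0, ∃ B ≥ 0, ∃ L ≥ 0, ∃ K ≥ 0, ∀ s ∈ Metric.ball (0 : Euc n) r,
        ∃ (A : Euc n →L[ℝ] Euc n) (w : Euc n → Euc n) (h : Euc n → Euc k),
          IsRecentredChart i R φ s δ B L K A w h := by
  obtain ⟨φ, hφp⟩ := exists_isC2ChartAt (n := n) p
  obtain ⟨hφ, hp, hp0⟩ := id hφp
  refine ⟨φ, hφp, ?_⟩
  have hpush := tangentPush_injective hi.isImmersion
  have h0 : (0 : Euc n) ∈ φ.target := hp0 ▸ φ.map_source hp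
  set G := embParam i φ with hG
  have hGc : ContDiffOn ℝ 2 G φ.target := contDiffOn_embParam hi.contMDiff hφ
  have hGapply : ∀ s ∈ φ.target, ∀ y, fderiv ℝ G s y =
      tangentPush i (φ.symm s) (mfderiv (𝓡 n) (𝓡 n) φ.symm s y) := fun s hs y =>
    fderiv_embParam_apply hi.contMDiff hφ hs y
  have hinj : Function.Injective (fderiv ℝ G 0) := fun y y' hy => by
    rw [hGapply 0 h0, hGapply 0 h0] at hy
    exact (bijective_mfderiv_symm hφ h0).1 (hpush _ hy)
  obtain ⟨r, hr, c, hc, L, hL, C, hC, hLr, hsub, hlip, hbd, hlow⟩ :=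
    exists_immersion_bounds φ.open_target h0 hGc hinj
  have hδ : 0 < c * r / 4 := by positivity
  refine ⟨r, hr, c * r / 4, hδ, C + 2 / c, by positivity, L * (2 / c) ^ 3, by positivity,
    L * (2 / c) ^ 2 + C * (L * (2 / c) ^ 3), by positivity, fun s hs => ?_⟩
  have hball : Metric.ball s r ⊆ Metric.ball (0 : Euc n) (2 * r) := by
    refine Metric.ball_subset_ball' ?_
    linarith [Metric.mem_ball.1 hs]
  have hss : s ∈ Metric.ball s r := Metric.mem_ball_self hr
  have hst : s ∈ φ.target := hsub (hball hss)
  have hS : R (φ.symm s) '' Set.range (fderiv ℝ G s) = Set.range (J : Euc n → Amb n k) := by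
    rw [hG, range_fderiv_embParam hi.contMDiff hφ hst]
    exact (hR (φ.symm s)).2
  obtain ⟨w, h, hw, hh, hcurv, hgraph⟩ := exists_graph hr hc hL hC
    (hGc.mono (hball.trans hsub)) (fun u hu v hv => hlip u (hball hu) v (hball hv))
    (fun u hu => hbd u (hball hu)) hLr (hlow s (hball hss)) hS
  have hGs : DifferentiableAt ℝ G s :=
    (hGc.contDiffAt (φ.open_target.mem_nhds hst)).differentiableAt (by norm_num)
  set F : Euc n → Euc n := fun u => firstPart (R (φ.symm s) (G u - G s)) with hF
  have hAeq : ∀ y, fderiv ℝ F s y = firstPart (R (φ.symm s) (fderiv ℝ G s y)) := fun y => by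
    rw [hF, fderiv_firstPart_rotate hGs]
    rfl
  have h0δ : (0 : Euc n) ∈ Metric.ball (0 : Euc n) (c * r / 4) := Metric.mem_ball_self hδ
  have hFs : F s = 0 := by
    change firstPart (R (φ.symm s) (G s - G s)) = 0
    rw [sub_self, LinearIsometryEquiv.map_zero]
    exact map_zero (fstCLM n k)
  have hw0 : w 0 = s := by
    have := hw.left_inv s hss (by rw [hFs]; exact h0δ)
    rwa [hFs] at this
  refine ⟨fderiv ℝ F s, w, h, ⟨hδ, hh, ?_⟩, hcurv, hw.contDiffOn, hw0, ?_, ?_, ?_,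
    hw.lipschitz_fderiv, fun f y hy => ?_⟩
  · exact locallyLooksLike_of_isLocalInverse hi.isEmbedding (hball.trans hsub)
      (hGc.continuousOn.mono (hball.trans hsub)) hw hgraph
  · have := hw.comp_fderiv 0 h0δ
    rwa [hw0] at this
  · refine ContinuousLinearMap.opNorm_le_bound _ (by positivity) fun y => ?_
    rw [hAeq, norm_firstPart_rotate hS]
    refine (ContinuousLinearMap.le_of_opNorm_le _ (hbd s (hball hss)) y).trans ?_
    gcongr
    have : 0 < 2 / c := by positivity
    linarith
  · linarith [hw.norm_fderiv_le 0 h0δ]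
  -- `R⁻¹ J (A y) = DG(s) y` since the rotated vector has no last part. Its lift is `Dφ⁻¹(s) y`, as
  -- `Di` is injective, so `π (A y)` evaluates `f` at `tauInv φ s y`.
  · have hpar : recentredParam i R f (φ.symm s) (fderiv ℝ F s y) =
        R (φ.symm s) (i (f (tauInv φ s y)) - i (φ.symm s)) := by
      have hlift : tangentLift i (φ.symm s) ((R (φ.symm s)).symm (J (fderiv ℝ F s y))) =
          mfderiv (𝓡 n) (𝓡 n) φ.symm s y := by
        rw [hAeq, ← rotate_eq_J hS, LinearIsometryEquiv.symm_apply_apply, hGapply s hst]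
        exact Function.leftInverse_invFun (hpush _) _
      rw [recentredParam, recentre, extrinsic, hlift]
      rfl
    obtain ⟨t, ht, htq⟩ := hy
    change pt t (h t) = _ at htq
    have hpi : piMap i R f (φ.symm s) (fderiv ℝ F s y) = t := by
      rw [piMap, ← htq, firstPart_pt]
    have hfy : f (tauInv φ s y) = φ.symm (w t) := by
      apply hi.isEmbedding.injective
      rw [hpar, ← hgraph t ht] at htq
      exact (sub_left_injective ((R (φ.symm s)).injective htq)).symm
    have hwt : w t ∈ φ.target := hsub (hball (hw.mapsTo t ht))
    rw [hpi]
    refine ⟨ht, ⟨hst, ?_⟩, ?_⟩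
    · change f (tauInv φ s y) ∈ φ.source
      rw [hfy]
      exact φ.map_target hwt
    · rw [localRep, hfy, φ.right_inv hwt]

end RecentredCharts

/-! ### Second-order chain rule -/

section SecondDerivativeComp

variable {E F G : Type*} [NormedAddCommGroup E] [NormedSpace ℝ E]
  [NormedAddCommGroup F] [NormedSpace ℝ F] [NormedAddCommGroup G] [NormedSpace ℝ G]

theorem HasD2At.congr_of_eventuallyEq {f g : E → F} {x : E} (hf : HasD2At f x)
    (h : g =ᶠ[𝓝 x] f) : HasD2At g x := by
  refine ⟨?_, h.fderiv.differentiableAt_iff.2 hf.2⟩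
  filter_upwards [hf.1, h.eventuallyEq_nhds] with y hy hgy
  exact hgy.differentiableAt_iff.2 hy

theorem _root_.Filter.EventuallyEq.fderiv_fderiv_eq {f g : E → F} {x : E} (h : g =ᶠ[𝓝 x] f) :
    fderiv ℝ (fderiv ℝ g) x = fderiv ℝ (fderiv ℝ f) x :=
  h.fderiv.fderiv_eq

theorem _root_.ContDiffAt.hasD2At {f : E → F} {x : E} (hf : ContDiffAt ℝ 2 f x) :
    HasD2At f x := by
  refine ⟨?_, (hf.fderiv_right (m := 1) (by norm_num)).differentiableAt (by norm_num)⟩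
  filter_upwards [hf.eventually (by simp)] with y hy using hy.differentiableAt (by norm_num)

/-- Second-order chain rule for `w ∘ π ∘ A` at `0`, where `A` is linear and `π` agrees with the
identity to first order. -/
theorem hasD2At_comp_comp_clm {w : F → G} {π : F → F} (A : E →L[ℝ] F) (hw : HasD2At w 0)
    (hπ : HasD2At π 0) (hπ0 : π 0 = 0) (hπ1 : HasFDerivAt π (ContinuousLinearMap.id ℝ F) 0) :
    HasD2At (fun y => w (π (A y))) 0 ∧
      ∀ η, fderiv ℝ (fderiv ℝ fun y => w (π (A y))) 0 η η =
        fderiv ℝ w 0 (fderiv ℝ (fderiv ℝ π) 0 (A η) (A η)) +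
          fderiv ℝ (fderiv ℝ w) 0 (A η) (A η) := by
  have hA0 : A 0 = 0 := map_zero A
  have hAt : Filter.Tendsto A (𝓝 0) (𝓝 0) := by
    simpa only [hA0] using A.continuous.tendsto 0
  have hπt : Filter.Tendsto (fun y => π (A y)) (𝓝 0) (𝓝 0) := by
    have := hπ1.continuousAt.tendsto
    rw [hπ0] at this
    exact this.comp hAt
  -- `D²π` is only assumed at `0`: the formula for the first derivative is set up nearby, then
  -- differentiated at the single point `0`.
  have hev : ∀ᶠ y in 𝓝 (0 : E), HasFDerivAt (fun y => w (π (A y)))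
      ((fderiv ℝ w (π (A y))).comp ((fderiv ℝ π (A y)).comp A)) y := by
    filter_upwards [hAt.eventually hπ.1, hπt.eventually hw.1] with y hy hwy
    exact hwy.hasFDerivAt.comp y (hy.hasFDerivAt.comp y A.hasFDerivAt)
  have hfd : fderiv ℝ (fun y => w (π (A y))) =ᶠ[𝓝 0]
      fun y => (fderiv ℝ w (π (A y))).comp ((fderiv ℝ π (A y)).comp A) :=
    hev.mono fun y hy => hy.fderiv
  have h1 : HasFDerivAt (fun y => fderiv ℝ w (π (A y)))
      ((fderiv ℝ (fderiv ℝ w) 0).comp ((ContinuousLinearMap.id ℝ F).comp A)) 0 := by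
    have hπA : HasFDerivAt (fun y => π (A y)) ((ContinuousLinearMap.id ℝ F).comp A) 0 := by
      refine HasFDerivAt.comp (0 : E) ?_ A.hasFDerivAt
      rwa [hA0]
    refine HasFDerivAt.comp (0 : E) ?_ hπA
    rw [hA0, hπ0]
    exact hw.2.hasFDerivAt
  have h2 : HasFDerivAt (fun y => fderiv ℝ π (A y)) ((fderiv ℝ (fderiv ℝ π) 0).comp A) 0 := by
    refine HasFDerivAt.comp (0 : E) ?_ A.hasFDerivAt
    rw [hA0]
    exact hπ.2.hasFDerivAt
  have h4 := h1.clm_comp (h2.clm_comp (hasFDerivAt_const A (0 : E)))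
  have h5 := h4.congr_of_eventuallyEq hfd
  refine ⟨⟨hev.mono fun y hy => hy.differentiableAt, h5.differentiableAt⟩, fun η => ?_⟩
  rw [h5.fderiv]
  simp [hA0, hπ0, hπ1.fderiv]

theorem hasFDerivAt_id_of_norm_sub_le_sq {π : E → E} {ρ b : ℝ} (hρ : 0 < ρ)
    (h : ∀ y ∈ Metric.ball (0 : E) ρ, ‖π y - y‖ ≤ b * ‖y‖ ^ 2) :
    π 0 = 0 ∧ HasFDerivAt π (ContinuousLinearMap.id ℝ E) 0 := by
  have h0 : π 0 = 0 := by
    have := h 0 (Metric.mem_ball_self hρ)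
    simpa using this
  refine ⟨h0, ?_⟩
  have hO : (fun y => π y - y) =O[𝓝 (0 : E)] fun y => ‖y - 0‖ ^ 2 := by
    refine Asymptotics.IsBigO.of_bound b ?_
    filter_upwards [Metric.ball_mem_nhds (0 : E) hρ] with y hy
    simpa using h y hy
  simpa using (hO.hasFDerivAt (𝕜 := ℝ) one_lt_two).fun_add (hasFDerivAt_id (𝕜 := ℝ) (0 : E))

end SecondDerivativeComp

/-! ### From condition D to C1 and C2 -/

section Conditions

variable {n k : ℕ} {M : Type*} [TopologicalSpace M] [ChartedSpace (Euc n) M]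
  {i : M → Amb n k} {R : M → (Amb n k ≃ₗᵢ[ℝ] Amb n k)} {φ : OpenPartialHomeomorph M (Euc n)}
  {f : TangentBundle (𝓡 n) M → M} {δ B L K : ℝ}

namespace IsRecentredChart

variable {s : Euc n} {A : Euc n →L[ℝ] Euc n} {w : Euc n → Euc n} {h : Euc n → Euc k}

theorem norm_apply_le (hc : IsRecentredChart i R φ s δ B L K A w h) (y : Euc n) :
    ‖A y‖ ≤ B * ‖y‖ :=
  A.le_of_opNorm_le hc.norm_le y

theorem contDiffAt_zero (hc : IsRecentredChart i R φ s δ B L K A w h) : ContDiffAt ℝ 2 w 0 :=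
  hc.contDiffOn.contDiffAt (Metric.ball_mem_nhds 0 hc.admissible.1)

/-- Near the zero vector, the local representative is defined and factors through `π`. -/
theorem eventually_localRep_eq (hc : IsRecentredChart i R φ s δ B L K A w h) {ρ : ℝ}
    (hρ : 0 < ρ) (hdom : Metric.ball 0 ρ ⊆ piDom i R f (φ.symm s) δ h) :
    ∃ ε > 0, ∀ y ∈ Metric.ball (0 : Euc n) ε, (s, y) ∈ localDom φ f ∧
      localRep φ f s y = w (piMap i R f (φ.symm s) (A y)) := by
  have hnhds : A ⁻¹' Metric.ball 0 ρ ∈ 𝓝 (0 : Euc n) :=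
    (Metric.isOpen_ball.preimage A.continuous).mem_nhds (by simpa using hρ)
  obtain ⟨ε, hε, hsub⟩ := Metric.mem_nhds_iff.1 hnhds
  exact ⟨ε, hε, fun y hy => (hc.localRep_eq f y (hdom (hsub hy))).2⟩

end IsRecentredChart

/-- C1 allows the ball in `y` to depend on `s`, so positivity of `τ` suffices. Any `ρ ≤ r` works, so
the radius found for C2 can be shared. -/
theorem c1In_of_isRecentredChart {r ρ : ℝ} (hρr : ρ ≤ r) (hB : 0 ≤ B) (hL : 0 ≤ L)
    (hδ : 0 < δ) (hK : 0 ≤ K)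
    (hcharts : ∀ s ∈ Metric.ball (0 : Euc n) r,
      ∃ (A : Euc n →L[ℝ] Euc n) (w : Euc n → Euc n) (h : Euc n → Euc k),
        IsRecentredChart i R φ s δ B L K A w h)
    {α τ : ℝ → ℝ → ℝ} (hD1 : D1 i R f τ) (hD2 : D2 i R f α) (hD4 : LocBddAbove α)
    (hfirst : PiFirstOrder i R f) (hτ : ∀ δ > 0, ∀ K ≥ 0, 0 < τ δ K) : C1In φ ρ f := by
  obtain ⟨a, ha⟩ := hD4 δ hδ K hK
  have hfact : ∀ s ∈ Metric.ball (0 : Euc n) ρ,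
      ∃ (A : Euc n →L[ℝ] Euc n) (w : Euc n → Euc n) (h : Euc n → Euc k),
        IsRecentredChart i R φ s δ B L K A w h ∧
        ∃ ε > 0, ∀ y ∈ Metric.ball (0 : Euc n) ε, (s, y) ∈ localDom φ f ∧
          localRep φ f s y = w (piMap i R f (φ.symm s) (A y)) := fun s hs => by
    obtain ⟨A, w, h, hc⟩ := hcharts s (Metric.ball_subset_ball hρr hs)
    exact ⟨A, w, h, hc, hc.eventually_localRep_eq (hτ δ hδ _ hc.curvBound_mem.1)
      (hD1 _ _ _ hc.admissible)⟩
  have hslice : SliceDom (localDom φ f) ρ := fun s hs => by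
    obtain ⟨A, w, h, hc, ε, hε, hy⟩ := hfact s hs
    exact ⟨ε, hε, fun y hyε => (hy y hyε).1⟩
  -- The two summands bound `D²w(0)(Aη, Aη)` and `Dw(0) D²π(0)(Aη, Aη)`.
  refine ⟨⟨hslice, fun s hs => ?_⟩, hslice, L * B ^ 2 + B * (|a| * B ^ 2), fun s hs => ?_⟩
  · obtain ⟨A, w, h, hc, ε, hε, hy⟩ := hfact s hs
    obtain ⟨hπ0, hπ1⟩ := hfirst _ _ _ hc.admissible
    have heq : localRep φ f s =ᶠ[𝓝 0] fun y => w (piMap i R f (φ.symm s) (A y)) :=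
      Filter.eventually_of_mem (Metric.ball_mem_nhds 0 hε) fun y hyε => (hy y hyε).2
    refine ⟨by rw [heq.eq_of_nhds, map_zero, hπ0, hc.map_zero], ?_⟩
    refine HasFDerivAt.congr_of_eventuallyEq ?_ heq
    rw [← hc.fderiv_comp]
    have hπA : HasFDerivAt (fun y => piMap i R f (φ.symm s) (A y)) A 0 := by
      have h1 : HasFDerivAt (piMap i R f (φ.symm s)) (ContinuousLinearMap.id ℝ (Euc n)) (A 0) := by
        rwa [map_zero]
      exact h1.comp (0 : Euc n) A.hasFDerivAt
    refine HasFDerivAt.comp (0 : Euc n) ?_ hπA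
    rw [map_zero, hπ0]
    exact (hc.contDiffAt_zero.differentiableAt (by norm_num)).hasFDerivAt
  · obtain ⟨A, w, h, hc, ε, hε, hy⟩ := hfact s hs
    obtain ⟨hπ0, hπ1⟩ := hfirst _ _ _ hc.admissible
    obtain ⟨hπ2, hπα⟩ := hD2 _ _ _ hc.admissible
    have heq : localRep φ f s =ᶠ[𝓝 0] fun y => w (piMap i R f (φ.symm s) (A y)) :=
      Filter.eventually_of_mem (Metric.ball_mem_nhds 0 hε) fun y hyε => (hy y hyε).2
    obtain ⟨hd2, hform⟩ := hasD2At_comp_comp_clm A hc.contDiffAt_zero.hasD2At hπ2 hπ0 hπ1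
    refine ⟨hd2.congr_of_eventuallyEq heq, normD2_le (by positivity) fun η hη => ?_⟩
    have hAη : ‖A η‖ ≤ B := by simpa [hη] using hc.norm_apply_le η
    have hπa : normD2 (piMap i R f (φ.symm s)) 0 ≤ |a| :=
      (hπα.trans (ha (Set.mem_image_of_mem _ hc.curvBound_mem))).trans (le_abs_self a)
    rw [heq.fderiv_fderiv_eq, hform]
    have e1 : ‖fderiv ℝ (fderiv ℝ w) 0 (A η) (A η)‖ ≤ L * B ^ 2 := by
      refine (norm_fderiv_fderiv_apply_le_normD2 w 0 (A η)).trans ?_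
      gcongr
      exact normD2_le_of_lipschitz Metric.isOpen_ball hL hc.lipschitz_fderiv
        (Metric.mem_ball_self hδ)
    have e2 : ‖fderiv ℝ w 0 (fderiv ℝ (fderiv ℝ (piMap i R f (φ.symm s))) 0 (A η) (A η))‖ ≤
        B * (|a| * B ^ 2) := by
      refine (ContinuousLinearMap.le_of_opNorm_le _ hc.norm_fderiv_le _).trans ?_
      gcongr
      refine (norm_fderiv_fderiv_apply_le_normD2 _ 0 (A η)).trans ?_
      gcongr
    exact (norm_add_le _ _).trans (by linarith)

theorem exists_c2In_of_isRecentredChart {r : ℝ} (hr : 0 < r) (hB : 0 ≤ B) (hL : 0 ≤ L)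
    (hδ : 0 < δ) (hK : 0 ≤ K)
    (hcharts : ∀ s ∈ Metric.ball (0 : Euc n) r,
      ∃ (A : Euc n →L[ℝ] Euc n) (w : Euc n → Euc n) (h : Euc n → Euc k),
        IsRecentredChart i R φ s δ B L K A w h)
    {β τ : ℝ → ℝ → ℝ} (hD1 : D1 i R f τ) (hD3 : D3 i R f β τ) (hD5 : LocBddAbove β)
    (hD6 : LocBddBelowPos τ) : ∃ ρ > 0, ρ ≤ r ∧ C2In φ ρ f := by
  obtain ⟨b', hb'⟩ := hD5 δ hδ K hK
  obtain ⟨ρ₀, hρ₀, hτ⟩ := hD6 δ hδ K hK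
  set b := |b'| with hb
  have hb0 : 0 ≤ b := abs_nonneg b'
  -- The radius forces `‖A y‖ < ρ₀`, inside the domain of `π`; `B + 1` avoids division by zero.
  have hfact : ∀ s ∈ Metric.ball (0 : Euc n) (min r (ρ₀ / (B + 1))),
      ∀ y ∈ Metric.ball (0 : Euc n) (min r (ρ₀ / (B + 1))), (s, y) ∈ localDom φ f ∧
        ‖localRep φ f s y - s - y‖ ≤
          (L * ((1 + b * ρ₀) * B) ^ 2 + B * (b * B ^ 2)) * ‖y‖ ^ 2 := fun s hs y hy => by
    obtain ⟨A, w, h, hc⟩ := hcharts s (Metric.ball_subset_ball (min_le_left _ _) hs)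
    have hyB : (B + 1) * ‖y‖ < ρ₀ := by
      have : ‖y‖ < ρ₀ / (B + 1) := (mem_ball_zero_iff.1 hy).trans_le (min_le_right _ _)
      rwa [lt_div_iff₀' (by positivity)] at this
    have hAy : ‖A y‖ ≤ B * ‖y‖ := hc.norm_apply_le y
    have hAρ : ‖A y‖ < ρ₀ := by linarith [norm_nonneg y]
    have hAτ : A y ∈ Metric.ball (0 : Euc n) (τ δ (curvBound δ h)) :=
      mem_ball_zero_iff.2 (hAρ.trans_le (hτ _ hc.curvBound_mem))
    obtain ⟨hπδ, hdom, hrep⟩ := hc.localRep_eq f y (hD1 _ _ _ hc.admissible hAτ)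
    set z := piMap i R f (φ.symm s) (A y) with hz
    have hzA : ‖z - A y‖ ≤ b * ‖A y‖ ^ 2 := by
      refine (hD3 _ _ _ hc.admissible _ hAτ).trans ?_
      gcongr
      exact (hb' (Set.mem_image_of_mem _ hc.curvBound_mem)).trans (le_abs_self b')
    have hzn : ‖z‖ ≤ (1 + b * ρ₀) * B * ‖y‖ := by
      have h1 : ‖z‖ ≤ ‖z - A y‖ + ‖A y‖ := by simpa using norm_add_le (z - A y) (A y)
      have h2 : b * ‖A y‖ ^ 2 ≤ b * ρ₀ * ‖A y‖ := by
        rw [pow_two, ← mul_assoc]; gcongr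
      have h3 : (1 + b * ρ₀) * ‖A y‖ ≤ (1 + b * ρ₀) * (B * ‖y‖) := by gcongr
      linarith
    have hDA : fderiv ℝ w 0 (A y) = y := DFunLike.congr_fun hc.fderiv_comp y
    -- Since `Dw(0) (A y) = y`, the error is the Taylor remainder of `w` at `z` plus `Dw(0)` applied
    -- to the D3 error; both are quadratic in `y`.
    have hsplit : localRep φ f s y - s - y =
        (w z - w 0 - fderiv ℝ w 0 z) + fderiv ℝ w 0 (z - A y) := by
      rw [hrep, hc.map_zero, map_sub, hDA]; abel
    have e1 : ‖w z - w 0 - fderiv ℝ w 0 z‖ ≤ L * ((1 + b * ρ₀) * B) ^ 2 * ‖y‖ ^ 2 := by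
      refine (norm_sub_fderiv_zero_le hL (fun t ht => (hc.contDiffOn.contDiffAt
        (Metric.isOpen_ball.mem_nhds ht)).differentiableAt (by norm_num))
        hc.lipschitz_fderiv hπδ).trans ?_
      rw [mul_assoc, ← mul_pow]
      gcongr
    have e2 : ‖fderiv ℝ w 0 (z - A y)‖ ≤ B * (b * B ^ 2) * ‖y‖ ^ 2 := by
      refine (ContinuousLinearMap.le_of_opNorm_le _ hc.norm_fderiv_le _).trans ?_
      rw [mul_assoc, mul_assoc, ← mul_pow]
      gcongr
      exact hzA.trans (by gcongr)
    refine ⟨hdom, ?_⟩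
    rw [hsplit, add_mul]
    exact (norm_add_le _ _).trans (add_le_add e1 e2)
  refine ⟨min r (ρ₀ / (B + 1)), by positivity, min_le_left _ _, ?_, _,
    fun s hs y hy => (hfact s hs y hy).2⟩
  rintro ⟨s, y⟩ ⟨hs, hy⟩
  exact (hfact s hs y hy).1

theorem LocBddBelowPos.pos {τ : ℝ → ℝ → ℝ} (h : LocBddBelowPos τ) :
    ∀ δ > 0, ∀ K ≥ 0, 0 < τ δ K := fun δ hδ K hK => by
  obtain ⟨c, hc, hτ⟩ := h δ hδ K hK
  exact hc.trans_le (hτ K ⟨hK, le_rfl⟩)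

theorem D3.piFirstOrder {β τ : ℝ → ℝ → ℝ} (hD3 : D3 i R f β τ) (hτ : LocBddBelowPos τ) :
    PiFirstOrder i R f := fun x δ h hadm =>
  hasFDerivAt_id_of_norm_sub_le_sq (hτ.pos δ hadm.1 _ (curvBound_nonneg δ h))
    (hD3 x δ h hadm)

end Conditions

end NewtonParam

open NewtonParam
theorem proposition14 {n k : ℕ} {M : Type*} [TopologicalSpace M] [ChartedSpace (Euc n) M]
    [IsManifold (𝓡 n) 2 M] (i : M → Amb n k)
    (hi : Manifold.IsSmoothEmbedding (𝓡 n) (𝓡 (n + k)) 2 i)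
    (R : M → (Amb n k ≃ₗᵢ[ℝ] Amb n k)) (hR : IsRotationFamily i R)
    (φ : TangentBundle (𝓡 n) M → M) :
    (ConditionD i R φ → ConditionsC1C2 φ φ) ∧
      (ConditionDForC1 i R φ → ConditionC1 φ) ∧
      (ConditionDForC2 i R φ → ConditionC2 φ) := by
  refine ⟨?_, ?_, ?_⟩
  · rintro ⟨α, β, ρ, hD1, hD2, hD3, hD4, hD5, hD6⟩ p
    obtain ⟨e, he, r, hr, δ, hδ, B, hB, L, hL, K, hK, hcharts⟩ := exists_isRecentredChart hi hR p
    -- C2 fixes the common radius; C1 then holds for it in the same chart, with `π(0) = 0` and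
    -- `Dπ(0) = I` supplied by D3 and D6.
    obtain ⟨ρ', hρ', hρr, hC2⟩ :=
      exists_c2In_of_isRecentredChart hr hB hL hδ hK hcharts hD1 hD3 hD5 hD6
    exact ⟨e, he, ρ', hρ', c1In_of_isRecentredChart hρr hB hL hδ hK hcharts hD1 hD2 hD4
      (hD3.piFirstOrder hD6) hD6.pos, hC2⟩
  · rintro ⟨α, ρ, hD1, hD2, hD4, hfirst, hρ⟩ p
    obtain ⟨e, he, r, hr, δ, hδ, B, hB, L, hL, K, hK, hcharts⟩ := exists_isRecentredChart hi hR p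
    exact ⟨e, he, r, hr, c1In_of_isRecentredChart le_rfl hB hL hδ hK hcharts hD1 hD2 hD4
      hfirst hρ⟩
  · rintro ⟨β, ρ, hD1, hD3, hD5, hD6⟩ p
    obtain ⟨e, he, r, hr, δ, hδ, B, hB, L, hL, K, hK, hcharts⟩ := exists_isRecentredChart hi hR p
    obtain ⟨ρ', hρ', -, hC2⟩ :=
      exists_c2In_of_isRecentredChart hr hB hL hδ hK hcharts hD1 hD3 hD5 hD6
    exact ⟨e, he, ρ', hρ', hC2⟩
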